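/- Let words be finite strings of natural numbers, and let $\Lambda$ be the empty word. The preorder $\precsim$ on words is defined recursively: $\Lambda\precsim\Lambda$; if $AB\neq\Lambda$ and $n$ is the smallest symbol of $AB$, write uniquely $A=A_1nA_2n\ldots nA_k$ and $B=B_1nB_2n\ldots nB_l$ with all symbols of the (possibly empty) words $A_i,B_j$ greater than $n$; then $A\precsim B$ iff the lexicographically maximal subsequence of $(A_1,\ldots,A_k)$ is lexicographically not greater than the lexicographically maximal subsequence of $(B_1,\ldots,B_l)$. Here sequences of words are compared lexicographically with respect to the already defined comparison of the shorter-alphabet words: $(C_1,\ldots,C_f)$ is not greater than $(D_1,\ldots,D_g)$ iff either $f\le g$ and $C_i\sim D_i$ for all $i\le f$, or for some $s<\min(f,g)$ we have $C_i\sim D_i$ for all $i\le s$ and $C_{s+1}\prec D_{s+1}$, where $A\sim B$ means $A\precsim B$ and $B\precsim A$, and $A\prec B$ means $A\precsim B$ and not $B\precsim A$. The set $\mathsf{NF}$ of words in normal form is defined inductively: $\Lambda\in\mathsf{NF}$; and if $k\ge 2$ and all symbols of $A_1,\ldots,A_k$ are greater than $n$, then $A_1nA_2n\ldots nA_k\in\mathsf{NF}$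 iff $A_k\precsim\ldots\precsim A_2\precsim A_1$ and $A_1,\ldots,A_k\in\mathsf{NF}$. Every word is $\sim$-equivalent to exactly one word in $\mathsf{NF}$. For $A\in\mathsf{NF}$ and $i\in\omega$ let $\Diamond_i A$ be the unique word in $\mathsf{NF}$ that is $\sim$-equivalent to $Ai$ (the word $A$ followed by the symbol $i$). For $\alpha\in[0,\omega]$ let $W_\alpha^N$ be the set of words in $\mathsf{NF}$ all of whose symbols are $\le\alpha$; it contains $\Lambda$ and is closed under $\Diamond_i$ for all $i\in\omega$ with $i\le\alpha$. **Theorem.** For every $\alpha\in[3,\omega]$, the elementary theory $$\mathbf{Th}\bigl(W_\alpha^N,\prec,\Lambda,\langle \Diamond_i\mid i\in\omega,\ i\le\alpha\rangle\bigr),$$ that is, the set of all first-order sentences (with equality) of this signature that are true in this structure, is undecidable. -/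

import Mathlib

/-! ### Words and their comparison -/

namespace WordNotation

/-- Words over the alphabet of all natural numbers; `[]` is the empty word `Λ`. -/
abbrev Word := List ℕ

/-- Lexicographic non-strict comparison of finite sequences of words with respect to `R`:
either all entries of the first sequence are `R`-equivalent to the corresponding entries of the
second one, which is at least as long, or at the first place where the entries are not
`R`-equivalent, the entry of the first sequence is strictly smaller. -/
def LexLE (R : Word → Word → Prop) : List Word → List Word → Prop
  | [], _ => True
  | _ :: _, [] => False
  | a :: l, b :: m => (R a b ∧ ¬ R b a) ∨ (R a b ∧ R b a ∧ LexLE R l m)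

/-- `C` is a lexicographically maximal subsequence of `As`. -/
def IsLexMax (R : Word → Word → Prop) (C As : List Word) : Prop :=
  C.Sublist As ∧ ∀ D : List Word, D.Sublist As → LexLE R D C

/-- The comparison of words in which at most `r` different symbols occur, by recursion on `r`.
`Λ ≾ Λ`; otherwise, if `n` is the minimal symbol of `AB`, then `A = A₁ n … n Aₖ` and
`B = B₁ n … n Bₗ` with all symbols of the `Aᵢ`, `Bⱼ` greater than `n`, and the lexicographically
maximal subsequences of `(A₁, …, Aₖ)` and `(B₁, …, Bₗ)` are compared lexicographically. -/
def PrecsimAux : ℕ → Word → Word → Prop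
  | 0, _, _ => True
  | r + 1, A, B =>
    match (A ++ B).min? with
    | none => True
    | some n => ∃ C D : List Word,
        IsLexMax (PrecsimAux r) C (A.splitOn n) ∧ IsLexMax (PrecsimAux r) D (B.splitOn n) ∧
          LexLE (PrecsimAux r) C D

/-- The preorder `≾` on words; the recursion depth is the number of different symbols. -/
def Precsim (A B : Word) : Prop := PrecsimAux (A ++ B).toFinset.card A B

/-- The equivalence `∼`. -/
def Sim (A B : Word) : Prop := Precsim A B ∧ Precsim B A

/-- The strict relation `≺`. -/
def Prec (A B : Word) : Prop := Precsim A B ∧ ¬ Precsim B A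

/-- Words in normal form: `Λ`, and `A₁ n A₂ n … n Aₖ` with `k ≥ 2`, where all symbols of the `Aᵢ`
are greater than `n`, `Aₖ ≾ … ≾ A₂ ≾ A₁`, and all `Aᵢ` are in normal form. -/
inductive NF : Word → Prop
  | nil : NF []
  | join (n : ℕ) (As : List Word) (hlen : 2 ≤ As.length) (hgt : ∀ A ∈ As, ∀ x ∈ A, n < x)
      (hsorted : As.IsChain (fun A B => Precsim B A)) (hNF : ∀ A ∈ As, NF A) :
      NF ([n].intercalate As)

/-! ### Well-definedness of the normal form of a word -/

theorem lexLE_congr {R R' : Word → Word → Prop} : ∀ {l m : List Word},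
    (∀ a ∈ l, ∀ b ∈ m, (R a b ↔ R' a b) ∧ (R b a ↔ R' b a)) → (LexLE R l m ↔ LexLE R' l m)
  | [], _, _ => by simp [LexLE]
  | _ :: _, [], _ => by simp [LexLE]
  | a :: l, b :: m, h => by
    have h0 := h a (by simp) b (by simp)
    have ih := lexLE_congr (l := l) (m := m) (R := R) (R' := R')
      (fun a ha b hb => h a (by simp [ha]) b (by simp [hb]))
    simp only [LexLE, h0.1, h0.2, ih]

theorem isLexMax_congr {R R' : Word → Word → Prop} {C As : List Word}
    (h : ∀ a ∈ As, ∀ b ∈ As, (R a b ↔ R' a b)) : IsLexMax R C As ↔ IsLexMax R' C As := by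
  unfold IsLexMax
  refine and_congr_right fun hC => forall_congr' fun D => forall_congr' fun hD => ?_
  exact lexLE_congr fun a ha b hb =>
    ⟨h a (hD.subset ha) b (hC.subset hb), h b (hC.subset hb) a (hD.subset ha)⟩

theorem mem_of_mem_splitOn {n : ℕ} {A X : Word} (hX : X ∈ A.splitOn n) {x : ℕ} (hx : x ∈ X) :
    x ∈ A ∧ x ≠ n := by
  induction A generalizing X with
  | nil => simp at hX; subst hX; simp at hx
  | cons a A ih =>
    rw [List.splitOn_cons_eq_if_modifyHead] at hX
    split_ifs at hX with h
    · rcases List.mem_cons.1 hX with rfl | hX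
      · simp at hx
      · exact ⟨List.mem_cons_of_mem _ (ih hX hx).1, (ih hX hx).2⟩
    · rcases hs : A.splitOn n with _ | ⟨Y, L⟩
      · simp [hs] at hX
      · rw [hs, List.modifyHead_cons] at hX
        rcases List.mem_cons.1 hX with rfl | hX
        · rcases List.mem_cons.1 hx with rfl | hx
          · exact ⟨by simp, by simpa using h⟩
          · have := ih (X := Y) (by simp [hs]) hx
            exact ⟨List.mem_cons_of_mem _ this.1, this.2⟩
        · have := ih (X := X) (by simp [hs, hX]) hx
          exact ⟨List.mem_cons_of_mem _ this.1, this.2⟩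

theorem splitOn_eq_singleton {n : ℕ} {A : Word} (h : n ∉ A) : A.splitOn n = [A] := by
  have := List.splitOn_intercalate (ls := [A]) n (by simpa using h) (by simp)
  simpa using this

theorem precsimAux_stable (r s : ℕ) (A B : Word) (hr : (A ++ B).toFinset.card ≤ r)
    (hs : (A ++ B).toFinset.card ≤ s) : PrecsimAux r A B ↔ PrecsimAux s A B := by
  induction r generalizing s A B with
  | zero =>
    have : A ++ B = [] := by simpa using hr
    cases s with
    | zero => rfl
    | succ s => simp [PrecsimAux, this]
  | succ r ih =>
    cases s with
    | zero =>
      have : A ++ B = [] := by simpa using hs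
      simp [PrecsimAux, this]
    | succ s =>
      unfold PrecsimAux
      cases hm : (A ++ B).min? with
      | none => simp
      | some n =>
        have hn : n ∈ A ++ B := List.min?_mem hm
        have key : ∀ a b : Word, (∀ x ∈ a, x ∈ A ++ B ∧ x ≠ n) → (∀ x ∈ b, x ∈ A ++ B ∧ x ≠ n) →
            (PrecsimAux r a b ↔ PrecsimAux s a b) := by
          intro a b ha hb
          have hlt : (a ++ b).toFinset.card < (A ++ B).toFinset.card := by
            apply Finset.card_lt_card
            refine (Finset.ssubset_iff_of_subset ?_).2 ⟨n, by simpa using hn, ?_⟩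
            · intro x hx
              rcases List.mem_append.1 (List.mem_toFinset.1 hx) with hx | hx
              · exact List.mem_toFinset.2 (ha x hx).1
              · exact List.mem_toFinset.2 (hb x hx).1
            · intro hx
              rcases List.mem_append.1 (List.mem_toFinset.1 hx) with hx | hx
              · exact (ha n hx).2 rfl
              · exact (hb n hx).2 rfl
          exact ih s a b (by omega) (by omega)
        have hA : ∀ X ∈ A.splitOn n, ∀ x ∈ X, x ∈ A ++ B ∧ x ≠ n := fun X hX x hx =>
          ⟨List.mem_append_left _ (mem_of_mem_splitOn hX hx).1, (mem_of_mem_splitOn hX hx).2⟩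
        have hB : ∀ X ∈ B.splitOn n, ∀ x ∈ X, x ∈ A ++ B ∧ x ≠ n := fun X hX x hx =>
          ⟨List.mem_append_right _ (mem_of_mem_splitOn hX hx).1, (mem_of_mem_splitOn hX hx).2⟩
        refine exists_congr fun C => exists_congr fun D => ?_
        rw [isLexMax_congr (fun a ha b hb => key a b (hA a ha) (hA b hb)),
          isLexMax_congr (fun a ha b hb => key a b (hB a ha) (hB b hb))]
        refine and_congr_right fun hC => and_congr_right fun hD => ?_
        exact lexLE_congr fun a ha b hb =>
          ⟨key a b (hA a (hC.1.subset ha)) (hB b (hD.1.subset hb)),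
            key b a (hB b (hD.1.subset hb)) (hA a (hC.1.subset ha))⟩

/-- The recursive characterization of `≾`. -/
theorem precsim_iff (A B : Word) : Precsim A B ↔
    ∀ n, (A ++ B).min? = some n → ∃ C D : List Word,
      IsLexMax Precsim C (A.splitOn n) ∧ IsLexMax Precsim D (B.splitOn n) ∧
        LexLE Precsim C D := by
  have h1 : Precsim A B ↔ PrecsimAux ((A ++ B).toFinset.card + 1) A B :=
    precsimAux_stable _ _ _ _ le_rfl (by omega)
  rw [h1]
  unfold PrecsimAux
  cases hm : (A ++ B).min? with
  | none => simp
  | some n =>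
    have key : ∀ a b : Word, (∀ x ∈ a, x ∈ A ++ B) → (∀ x ∈ b, x ∈ A ++ B) →
        (PrecsimAux (A ++ B).toFinset.card a b ↔ Precsim a b) := by
      intro a b ha hb
      refine precsimAux_stable _ _ _ _ (Finset.card_le_card ?_) le_rfl
      intro x hx
      rcases List.mem_append.1 (List.mem_toFinset.1 hx) with hx | hx
      · exact List.mem_toFinset.2 (ha x hx)
      · exact List.mem_toFinset.2 (hb x hx)
    have hA : ∀ X ∈ A.splitOn n, ∀ x ∈ X, x ∈ A ++ B := fun X hX x hx =>
      List.mem_append_left _ (mem_of_mem_splitOn hX hx).1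
    have hB : ∀ X ∈ B.splitOn n, ∀ x ∈ X, x ∈ A ++ B := fun X hX x hx =>
      List.mem_append_right _ (mem_of_mem_splitOn hX hx).1
    simp only [Option.some.injEq, forall_eq']
    refine exists_congr fun C => exists_congr fun D => ?_
    rw [isLexMax_congr (fun a ha b hb => key a b (hA a ha) (hA b hb)),
      isLexMax_congr (fun a ha b hb => key a b (hB a ha) (hB b hb))]
    refine and_congr_right fun hC => and_congr_right fun hD => ?_
    exact lexLE_congr fun a ha b hb =>
      ⟨key a b (hA a (hC.1.subset ha)) (hB b (hD.1.subset hb)),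
        key b a (hB b (hD.1.subset hb)) (hA a (hC.1.subset ha))⟩

/-- `R` is a linear preorder on the words that satisfy `P`. -/
structure LinPre (P : Word → Prop) (R : Word → Word → Prop) : Prop where
  total : ∀ a b, P a → P b → R a b ∨ R b a
  trans : ∀ a b c, P a → P b → P c → R a b → R b c → R a c

section Lex

variable {P : Word → Prop} {R : Word → Word → Prop}

theorem LinPre.refl (h : LinPre P R) {a : Word} (ha : P a) : R a a := by
  simpa using h.total a a ha ha

theorem LinPre.lex_total (h : LinPre P R) : ∀ {l m : List Word}, (∀ a ∈ l, P a) →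
    (∀ a ∈ m, P a) → LexLE R l m ∨ LexLE R m l
  | [], _, _, _ => by simp [LexLE]
  | _ :: _, [], _, _ => by simp [LexLE]
  | a :: l, b :: m, hl, hm => by
    have h1 := h.total a b (hl a (by simp)) (hm b (by simp))
    have h2 := h.lex_total (l := l) (m := m) (fun a ha => hl a (by simp [ha]))
      (fun a ha => hm a (by simp [ha]))
    simp only [LexLE]
    tauto

theorem LinPre.lex_trans (h : LinPre P R) : ∀ {l m k : List Word}, (∀ a ∈ l, P a) →
    (∀ a ∈ m, P a) → (∀ a ∈ k, P a) → LexLE R l m → LexLE R m k → LexLE R l k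
  | [], _, _, _, _, _, _, _ => by simp [LexLE]
  | _ :: _, [], _, _, _, _, h1, _ => by simp [LexLE] at h1
  | _ :: _, _ :: _, [], _, _, _, _, h2 => by simp [LexLE] at h2
  | a :: l, b :: m, c :: k, hl, hm, hk, h1, h2 => by
    have pa := hl a (by simp)
    have pb := hm b (by simp)
    have pc := hk c (by simp)
    have ih := h.lex_trans (l := l) (m := m) (k := k) (fun a ha => hl a (by simp [ha]))
      (fun a ha => hm a (by simp [ha])) (fun a ha => hk a (by simp [ha]))
    have t1 := h.trans a b c pa pb pc
    have t2 := h.trans c b a pc pb pa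
    have t3 := h.trans b c a pb pc pa
    have t4 := h.trans c a b pc pa pb
    simp only [LexLE] at h1 h2 ⊢
    tauto

theorem LinPre.exists_max (h : LinPre P R) : ∀ (L : List (List Word)), L ≠ [] →
    (∀ l ∈ L, ∀ a ∈ l, P a) → ∃ c ∈ L, ∀ d ∈ L, LexLE R d c
  | [], h0, _ => absurd rfl h0
  | [l], _, hL => ⟨l, by simp, by
      have := h.lex_total (hL l (by simp)) (hL l (by simp))
      simpa using this⟩
  | l :: l' :: L, _, hL => by
    obtain ⟨c, hc, hmax⟩ := h.exists_max (l' :: L) (by simp) (fun l hl => hL l (by simp_all))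
    have pl := hL l (by simp)
    have pc := hL c (List.mem_cons_of_mem _ hc)
    rcases h.lex_total pl pc with h1 | h1
    · refine ⟨c, List.mem_cons_of_mem _ hc, fun d hd => ?_⟩
      rcases List.mem_cons.1 hd with rfl | hd
      · exact h1
      · exact hmax d hd
    · refine ⟨l, by simp, fun d hd => ?_⟩
      rcases List.mem_cons.1 hd with rfl | hd
      · simpa using h.lex_total pl pl
      · exact h.lex_trans (hL d (List.mem_cons_of_mem _ hd)) pc pl (hmax d hd) h1

theorem LinPre.exists_isLexMax (h : LinPre P R) (As : List Word) (hA : ∀ a ∈ As, P a) :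
    ∃ C, IsLexMax R C As := by
  obtain ⟨c, hc, hmax⟩ := h.exists_max As.sublists
    (List.ne_nil_of_mem (List.mem_sublists.2 (List.Sublist.refl As)))
    (fun l hl a ha => hA a ((List.mem_sublists.1 hl).subset ha))
  exact ⟨c, List.mem_sublists.1 hc, fun D hD => hmax D (List.mem_sublists.2 hD)⟩

/-- A non-increasing sequence is its own lexicographically maximal subsequence. -/
theorem LinPre.isLexMax_of_pairwise (h : LinPre P R) : ∀ {As : List Word}, (∀ a ∈ As, P a) →
    As.Pairwise (fun a b => R b a) → IsLexMax R As As
  | [], _, _ => ⟨List.Sublist.refl _, fun D hD => by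
      rw [List.sublist_nil.1 hD]; simp [LexLE]⟩
  | a :: As, hA, hs => ⟨List.Sublist.refl _, fun D hD => by
      have ih := h.isLexMax_of_pairwise (As := As) (fun a ha => hA a (by simp [ha])) hs.of_cons
      have hs1 := (List.pairwise_cons.1 hs).1
      cases D with
      | nil => simp [LexLE]
      | cons d D =>
        have hd : R d a := by
          rcases List.mem_cons.1 (hD.subset (List.mem_cons_self ..)) with rfl | hd
          · exact h.refl (hA _ (by simp))
          · exact hs1 d hd
        have hDs : D.Sublist As := by simpa using hD.tail
        have := ih.2 D hDs
        simp only [LexLE]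
        tauto⟩

/-- A lexicographically maximal subsequence is non-increasing. -/
theorem LinPre.pairwise_of_isLexMax (_ : LinPre P R) {C As : List Word} (hA : ∀ a ∈ As, P a)
    (hC : IsLexMax R C As) : C.Pairwise (fun a b => R b a) := by
  have main : ∀ C : List Word, (∀ a ∈ C, P a) → (∀ D, D.Sublist C → LexLE R D C) →
      C.Pairwise (fun a b => R b a) := by
    intro C
    induction C with
    | nil => intros; exact List.Pairwise.nil
    | cons c C ih =>
      intro hP hD
      have pc := hP c (by simp)
      refine List.Pairwise.cons ?_ (ih (fun a ha => hP a (by simp [ha])) fun D hDs => ?_)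
      · intro b hb
        have := hD [b] (by simpa using Or.inr hb)
        simp only [LexLE] at this
        tauto
      · have := hD (c :: D) (hDs.cons_cons c)
        simp only [LexLE] at this
        tauto
  exact main C (fun a ha => hA a (hC.1.subset ha)) fun D hD => hC.2 D (hD.trans hC.1)

theorem LinPre.isLexMax_ne_nil (h : LinPre P R) {C As : List Word} (hA : As ≠ [])
    (hC : IsLexMax R C As) : C ≠ [] := by
  rintro rfl
  have := hC.2 As (List.Sublist.refl _)
  cases As <;> simp_all [LexLE]

theorem lexLE_of_forall₂ {l m : List Word} (hlm : List.Forall₂ (fun a b => R a b ∧ R b a) l m) :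
    LexLE R l m := by
  induction hlm with
  | nil => simp [LexLE]
  | cons h1 _ ih => simp only [LexLE]; tauto

theorem forall₂_of_lexLE : ∀ {l m : List Word}, LexLE R l m → LexLE R m l →
    List.Forall₂ (fun a b => R a b ∧ R b a) l m
  | [], [], _, _ => .nil
  | [], _ :: _, _, h2 => by simp [LexLE] at h2
  | _ :: _, [], h1, _ => by simp [LexLE] at h1
  | a :: l, b :: m, h1, h2 => by
    simp only [LexLE] at h1 h2
    exact .cons (by tauto) (forall₂_of_lexLE (by tauto) (by tauto))

end Lex

/-- All symbols of the word lie in `[n, n + r)`. -/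
def InRange (n r : ℕ) (A : Word) : Prop := ∀ x ∈ A, n ≤ x ∧ x < n + r

theorem InRange.splitOn {n r : ℕ} {A : Word} (hA : InRange n (r + 1) A) :
    ∀ X ∈ A.splitOn n, InRange (n + 1) r X := by
  intro X hX x hx
  have h1 := mem_of_mem_splitOn hX hx
  have := hA x h1.1
  omega

/-- The characterization of `≾` by splitting at any lower bound of the occurring symbols. -/
theorem precsim_iff_splitOn {n r : ℕ} (h : LinPre (InRange (n + 1) r) Precsim) {A B : Word}
    (hA : InRange n (r + 1) A) (hB : InRange n (r + 1) B) : Precsim A B ↔ ∃ C D : List Word,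
      IsLexMax Precsim C (A.splitOn n) ∧ IsLexMax Precsim D (B.splitOn n) ∧
        LexLE Precsim C D := by
  by_cases hn : n ∈ A ++ B
  · have hm : (A ++ B).min? = some n := by
      rw [List.min?_eq_some_iff]
      refine ⟨hn, fun b hb => ?_⟩
      rcases List.mem_append.1 hb with hb | hb
      · exact (hA b hb).1
      · exact (hB b hb).1
    rw [precsim_iff, hm]
    simp
  · rw [List.mem_append, not_or] at hn
    have eA := splitOn_eq_singleton hn.1
    have eB := splitOn_eq_singleton hn.2
    have pA : InRange (n + 1) r A := hA.splitOn A (by simp [eA])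
    have pB : InRange (n + 1) r B := hB.splitOn B (by simp [eB])
    have hmax : ∀ {X : Word} {C : List Word}, InRange (n + 1) r X →
        (IsLexMax Precsim C [X] ↔ C = [X]) := by
      intro X C hX
      constructor
      · intro hC
        have := h.isLexMax_ne_nil (by simp) hC
        have h2 := hC.1
        rcases List.sublist_singleton.1 h2 with h3 | h3
        · exact absurd h3 this
        · exact h3
      · rintro rfl
        exact h.isLexMax_of_pairwise (by simpa using hX) (List.pairwise_singleton _ _)
    rw [eA, eB]
    simp only [hmax pA, hmax pB, exists_and_left, exists_eq_left, LexLE]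
    tauto

theorem linPre_inRange (r n : ℕ) : LinPre (InRange n r) Precsim := by
  induction r generalizing n with
  | zero =>
    have hnil : ∀ A, InRange n 0 A → A = [] := by
      intro A hA
      rw [List.eq_nil_iff_forall_not_mem]
      intro x hx
      have := hA x hx
      omega
    have h0 : Precsim [] [] := by simp [Precsim, PrecsimAux]
    constructor
    · intro a b ha hb
      rw [hnil a ha, hnil b hb]
      exact Or.inl h0
    · intro a b c ha hb hc _ _
      rw [hnil a ha, hnil c hc]
      exact h0
  | succ r ih =>
    have ih := ih (n + 1)
    constructor
    · intro a b ha hb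
      obtain ⟨C, hC⟩ := ih.exists_isLexMax _ ha.splitOn
      obtain ⟨D, hD⟩ := ih.exists_isLexMax _ hb.splitOn
      rw [precsim_iff_splitOn ih ha hb, precsim_iff_splitOn ih hb ha]
      rcases ih.lex_total (fun x hx => ha.splitOn x (hC.1.subset hx))
        (fun x hx => hb.splitOn x (hD.1.subset hx)) with h1 | h1
      · exact Or.inl ⟨C, D, hC, hD, h1⟩
      · exact Or.inr ⟨D, C, hD, hC, h1⟩
    · intro a b c ha hb hc hab hbc
      rw [precsim_iff_splitOn ih ha hb] at hab
      rw [precsim_iff_splitOn ih hb hc] at hbc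
      rw [precsim_iff_splitOn ih ha hc]
      obtain ⟨C, D, hC, hD, h1⟩ := hab
      obtain ⟨D', E, hD', hE, h2⟩ := hbc
      have pC := fun x hx => ha.splitOn x (hC.1.subset hx)
      have pD := fun x hx => hb.splitOn x (hD.1.subset hx)
      have pD' := fun x hx => hb.splitOn x (hD'.1.subset hx)
      have pE := fun x hx => hc.splitOn x (hE.1.subset hx)
      exact ⟨C, E, hC, hE, ih.lex_trans pC pD pE h1
        (ih.lex_trans pD pD' pE (hD'.2 D hD.1) h2)⟩

theorem exists_inRange (A : Word) : ∃ r, ∀ s, r ≤ s → InRange 0 s A := by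
  induction A with
  | nil => exact ⟨0, fun s _ x hx => by simp at hx⟩
  | cons a A ih =>
    obtain ⟨r, hr⟩ := ih
    refine ⟨max r (a + 1), fun s hs x hx => ?_⟩
    rcases List.mem_cons.1 hx with rfl | hx
    · omega
    · exact hr s (by omega) x hx

/-- `≾` is a linear preorder on the set of all words. -/
theorem linPre_precsim : LinPre (fun _ => True) Precsim := by
  constructor
  · intro a b _ _
    obtain ⟨r, hr⟩ := exists_inRange a
    obtain ⟨s, hs⟩ := exists_inRange b
    exact (linPre_inRange (max r s) 0).total a b (hr _ (by omega)) (hs _ (by omega))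
  · intro a b c _ _ _
    obtain ⟨r, hr⟩ := exists_inRange a
    obtain ⟨s, hs⟩ := exists_inRange b
    obtain ⟨t, ht⟩ := exists_inRange c
    exact (linPre_inRange (max r (max s t)) 0).trans a b c (hr _ (by omega)) (hs _ (by omega))
      (ht _ (by omega))

theorem precsim_iff_of_ge {n : ℕ} {A B : Word} (hA : ∀ x ∈ A, n ≤ x) (hB : ∀ x ∈ B, n ≤ x) :
    Precsim A B ↔ ∃ C D : List Word,
      IsLexMax Precsim C (A.splitOn n) ∧ IsLexMax Precsim D (B.splitOn n) ∧
        LexLE Precsim C D := by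
  obtain ⟨r, hr⟩ := exists_inRange A
  obtain ⟨s, hs⟩ := exists_inRange B
  refine precsim_iff_splitOn (r := max r s) (linPre_inRange _ _) (fun x hx => ⟨hA x hx, ?_⟩)
    (fun x hx => ⟨hB x hx, ?_⟩)
  · have := hr (max r s) (by omega) x hx
    omega
  · have := hs (max r s) (by omega) x hx
    omega

theorem mem_intercalate {n : ℕ} {As : List Word} {x : ℕ} (hx : x ∈ [n].intercalate As) :
    (x = n ∧ 2 ≤ As.length) ∨ ∃ A ∈ As, x ∈ A := by
  induction As with
  | nil => simp at hx
  | cons A As ih =>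
    cases As with
    | nil => simpa using hx
    | cons B Bs =>
      rw [List.intercalate_cons_cons] at hx
      simp only [List.mem_append, List.mem_singleton] at hx
      rcases hx with (hx | hx) | hx
      · exact Or.inr ⟨A, by simp, hx⟩
      · exact Or.inl ⟨hx, by simp⟩
      · rcases ih hx with h1 | ⟨B', hB', h1⟩
        · exact Or.inl ⟨h1.1, by simp⟩
        · exact Or.inr ⟨B', List.mem_cons_of_mem _ hB', h1⟩

theorem mem_intercalate_self {n : ℕ} {As : List Word} (h : 2 ≤ As.length) :
    n ∈ [n].intercalate As := by
  match As, h with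
  | A :: B :: Bs, _ =>
    rw [List.intercalate_cons_cons]
    simp

theorem pairwise_of_isChain {As : List Word} (h : As.IsChain (fun A B => Precsim B A)) :
    As.Pairwise (fun A B => Precsim B A) := by
  have : IsTrans Word (fun A B : Word => Precsim B A) :=
    ⟨fun a b c hab hbc => linPre_precsim.trans c b a trivial trivial trivial hbc hab⟩
  exact List.isChain_iff_pairwise.1 h

/-- The blocks of a normal form are non-increasing normal forms. -/
theorem NF.splitOn {n : ℕ} {A : Word} (h : NF A) (hA : ∀ x ∈ A, n ≤ x) :
    (A.splitOn n).Pairwise (fun A B => Precsim B A) ∧ ∀ X ∈ A.splitOn n, NF X := by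
  by_cases hn : n ∈ A
  · cases h with
    | nil => simp at hn
    | join m As hlen hgt hs hNF =>
      have hmn : m = n := by
        have h1 := hA m (mem_intercalate_self hlen)
        rcases mem_intercalate hn with h2 | ⟨X, hX, h2⟩
        · exact h2.1.symm
        · have := hgt X hX n h2
          omega
      subst hmn
      rw [List.splitOn_intercalate m (fun l hl hm => lt_irrefl _ (hgt l hl m hm))
        (by rintro rfl; simp at hlen)]
      exact ⟨pairwise_of_isChain hs, hNF⟩
  · rw [splitOn_eq_singleton hn]
    exact ⟨List.pairwise_singleton _ _, by simpa using h⟩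

theorem nf_unique_aux (r n : ℕ) (A B : Word) (hA : InRange n r A) (hB : InRange n r B)
    (nA : NF A) (nB : NF B) (h : Sim A B) : A = B := by
  induction r generalizing n A B with
  | zero =>
    have hnil : ∀ A, InRange n 0 A → A = [] := by
      intro A hA
      rw [List.eq_nil_iff_forall_not_mem]
      intro x hx
      have := hA x hx
      omega
    rw [hnil A hA, hnil B hB]
  | succ r ih =>
    have gA : ∀ x ∈ A, n ≤ x := fun x hx => (hA x hx).1
    have gB : ∀ x ∈ B, n ≤ x := fun x hx => (hB x hx).1
    have sA := nA.splitOn gA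
    have sB := nB.splitOn gB
    have T : ∀ L : List Word, ∀ a ∈ L, True := fun _ _ _ => trivial
    have mA := linPre_precsim.isLexMax_of_pairwise (T _) sA.1
    have mB := linPre_precsim.isLexMax_of_pairwise (T _) sB.1
    obtain ⟨C, D, hC, hD, h1⟩ := (precsim_iff_of_ge gA gB).1 h.1
    obtain ⟨D', C', hD', hC', h2⟩ := (precsim_iff_of_ge gB gA).1 h.2
    have e1 : LexLE Precsim (A.splitOn n) (B.splitOn n) :=
      linPre_precsim.lex_trans (T _) (T _) (T _) (hC.2 _ mA.1)
        (linPre_precsim.lex_trans (T _) (T _) (T _) h1 (mB.2 _ hD.1))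
    have e2 : LexLE Precsim (B.splitOn n) (A.splitOn n) :=
      linPre_precsim.lex_trans (T _) (T _) (T _) (hD'.2 _ mB.1)
        (linPre_precsim.lex_trans (T _) (T _) (T _) h2 (mA.2 _ hC'.1))
    have key : ∀ l m : List Word, List.Forall₂ (fun a b => Precsim a b ∧ Precsim b a) l m →
        (∀ a ∈ l, a ∈ A.splitOn n) → (∀ b ∈ m, b ∈ B.splitOn n) → l = m := by
      intro l m hlm
      induction hlm with
      | nil => intros; rfl
      | cons hab _ ih' =>
        intro hl hm
        have ha := hl _ (List.mem_cons_self ..)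
        have hb := hm _ (List.mem_cons_self ..)
        rw [ih (n + 1) _ _ (hA.splitOn _ ha) (hB.splitOn _ hb) (sA.2 _ ha) (sB.2 _ hb) hab,
          ih' (fun a ha => hl a (List.mem_cons_of_mem _ ha))
            (fun b hb => hm b (List.mem_cons_of_mem _ hb))]
    have := key _ _ (forall₂_of_lexLE e1 e2) (fun _ h => h) (fun _ h => h)
    rw [← List.intercalate_splitOn (xs := A) n, this, List.intercalate_splitOn]

theorem nf_exists_aux (r n : ℕ) (A : Word) (hA : InRange n r A) :
    ∃ B, NF B ∧ Sim A B ∧ B ⊆ A := by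
  have T : ∀ L : List Word, ∀ a ∈ L, True := fun _ _ _ => trivial
  induction r generalizing n A with
  | zero =>
    have : A = [] := by
      rw [List.eq_nil_iff_forall_not_mem]
      intro x hx
      have := hA x hx
      omega
    subst this
    have h0 : Precsim [] [] := by simp [Precsim, PrecsimAux]
    exact ⟨[], NF.nil, ⟨h0, h0⟩, by simp⟩
  | succ r ih =>
    have gA : ∀ x ∈ A, n ≤ x := fun x hx => (hA x hx).1
    obtain ⟨C, hC⟩ := linPre_precsim.exists_isLexMax (A.splitOn n) (T _)
    have key : ∀ L : List Word, L.Sublist (A.splitOn n) → ∃ M : List Word,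
        List.Forall₂ (fun a b => Precsim a b ∧ Precsim b a) L M ∧
        ∀ b ∈ M, NF b ∧ ∀ x ∈ b, x ∈ A ∧ n < x := by
      intro L hL
      induction L with
      | nil => exact ⟨[], .nil, by simp⟩
      | cons a L ihL =>
        obtain ⟨M, hM, hM'⟩ := ihL ((List.sublist_cons_self a L).trans hL)
        have ha : a ∈ A.splitOn n := hL.subset (List.mem_cons_self ..)
        obtain ⟨b, hb, hab, hsub⟩ := ih (n + 1) a (hA.splitOn a ha)
        refine ⟨b :: M, .cons hab hM, fun b' hb' => ?_⟩
        rcases List.mem_cons.1 hb' with rfl | hb'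
        · refine ⟨hb, fun x hx => ⟨(mem_of_mem_splitOn ha (hsub hx)).1, ?_⟩⟩
          have := hA.splitOn a ha x (hsub hx)
          omega
        · exact hM' b' hb'
    obtain ⟨M, hCM, hM⟩ := key C hC.1
    have hCne : C ≠ [] := linPre_precsim.isLexMax_ne_nil (by simp) hC
    have hlen := hCM.length_eq
    have hMne : M ≠ [] := by
      rintro rfl
      exact hCne (List.length_eq_zero_iff.1 (by simpa using hlen))
    have hMs : M.Pairwise (fun a b => Precsim b a) := by
      have hCs := linPre_precsim.pairwise_of_isLexMax (T _) hC
      clear key hM hMne hlen hCne hC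
      have aux : ∀ {L M : List Word} {c d : Word}, Sim c d →
          List.Forall₂ (fun a b => Precsim a b ∧ Precsim b a) L M →
          (∀ a ∈ L, Precsim a c) → ∀ b ∈ M, Precsim b d := by
        intro L M c d hcd hLM
        induction hLM with
        | nil => simp
        | cons hab _ ih2 =>
          intro hL b hb
          rcases List.mem_cons.1 hb with rfl | hb
          · exact linPre_precsim.trans _ _ _ trivial trivial trivial hab.2
              (linPre_precsim.trans _ _ _ trivial trivial trivial
                (hL _ (List.mem_cons_self ..)) hcd.1)
          · exact ih2 (fun a ha => hL a (List.mem_cons_of_mem _ ha)) b hb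
      induction hCM with
      | nil => exact .nil
      | cons hab hLM ih2 =>
        rw [List.pairwise_cons] at hCs
        exact .cons (aux hab hLM hCs.1) (ih2 hCs.2)
    have hnM : ∀ l ∈ M, n ∉ l := fun l hl hn => lt_irrefl _ ((hM l hl).2 n hn).2
    have hsplit : ([n].intercalate M).splitOn n = M := List.splitOn_intercalate n hnM hMne
    have gB : ∀ x ∈ [n].intercalate M, n ≤ x := by
      intro x hx
      rcases mem_intercalate hx with h1 | ⟨X, hX, h1⟩
      · exact h1.1.ge
      · exact ((hM X hX).2 x h1).2.le
    have hMmax : IsLexMax Precsim M (([n].intercalate M).splitOn n) := by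
      rw [hsplit]
      exact linPre_precsim.isLexMax_of_pairwise (T _) hMs
    have hCM' : List.Forall₂ (fun a b => Precsim a b ∧ Precsim b a) M C :=
      hCM.flip.imp fun _ _ h => ⟨h.2, h.1⟩
    refine ⟨[n].intercalate M, ?_, ⟨?_, ?_⟩, ?_⟩
    · by_cases h2 : 2 ≤ M.length
      · exact NF.join n M h2 (fun X hX x hx => ((hM X hX).2 x hx).2) hMs.isChain
          (fun X hX => (hM X hX).1)
      · have h1 : M.length = 1 := by
          have := List.length_pos_of_ne_nil hMne
          omega
        obtain ⟨X, rfl⟩ := List.length_eq_one_iff.1 h1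
        simpa using (hM X (by simp)).1
    · exact (precsim_iff_of_ge gA gB).2 ⟨C, M, hC, hMmax, lexLE_of_forall₂ hCM⟩
    · exact (precsim_iff_of_ge gB gA).2 ⟨M, C, hMmax, hC, lexLE_of_forall₂ hCM'⟩
    · intro x hx
      rcases mem_intercalate hx with ⟨rfl, h1⟩ | ⟨X, hX, h1⟩
      · by_contra hn
        rw [splitOn_eq_singleton hn] at hC
        have := hC.1.length_le
        simp at this
        omega
      · exact ((hM X hX).2 x h1).1

/-- Every word is equivalent to a unique word in normal form. -/
theorem existsUnique_nf (A : Word) : ∃! B, NF B ∧ Sim A B := by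
  obtain ⟨r, hr⟩ := exists_inRange A
  obtain ⟨B, hB, hAB, hsub⟩ := nf_exists_aux r 0 A (hr r le_rfl)
  refine ⟨B, ⟨hB, hAB⟩, fun B' h' => ?_⟩
  obtain ⟨s, hs⟩ := exists_inRange B
  obtain ⟨t, ht⟩ := exists_inRange B'
  refine nf_unique_aux (max s t) 0 B' B (ht _ (by omega)) (hs _ (by omega)) h'.1 hB ⟨?_, ?_⟩
  · exact linPre_precsim.trans _ _ _ trivial trivial trivial h'.2.2 hAB.1
  · exact linPre_precsim.trans _ _ _ trivial trivial trivial hAB.2 h'.2.1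

/-- The normal form of `A`: the unique word in normal form that is equivalent to `A`. -/
noncomputable def normalForm (A : Word) : Word := (existsUnique_nf A).choose

theorem normalForm_spec (A : Word) : NF (normalForm A) ∧ Sim A (normalForm A) :=
  (existsUnique_nf A).choose_spec.1

theorem normalForm_subset (A : Word) : normalForm A ⊆ A := by
  obtain ⟨r, hr⟩ := exists_inRange A
  obtain ⟨B, hB, hAB, hsub⟩ := nf_exists_aux r 0 A (hr r le_rfl)
  rwa [(existsUnique_nf A).unique (normalForm_spec A) ⟨hB, hAB⟩]

/-! ### The structures -/

/-- `W_α^N`: the words in normal form all of whose symbols are `≤ α`, for `α ∈ [0, ω]`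
(`ω` is `⊤ : ℕ∞`). -/
def WN (α : ℕ∞) : Type := {A : Word // NF A ∧ ∀ x ∈ A, (x : ℕ∞) ≤ α}

/-- The empty word `Λ` as an element of `W_α^N`. -/
def WN.empty (α : ℕ∞) : WN α := ⟨[], NF.nil, by simp⟩

/-- The operator `◇ᵢ`, `i ≤ α`, on `W_α^N`: `◇ᵢ A` is the word in normal form equivalent
to the word `A i`. -/
noncomputable def WN.diamond {α : ℕ∞} (i : ℕ) (hi : (i : ℕ∞) ≤ α) (A : WN α) : WN α :=
  ⟨normalForm (A.1 ++ [i]), (normalForm_spec _).1, fun x hx => by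
    have := normalForm_subset _ hx
    rcases List.mem_append.1 this with h | h
    · exact A.2.2 x h
    · rw [List.mem_singleton.1 h]; exact hi⟩

/-- Function symbols of the signature `(≺, Λ, ⟨◇ᵢ ∣ i ∈ ω, i ≤ α⟩)`. -/
inductive NotationFunc (α : ℕ∞) : ℕ → Type
  | empty : NotationFunc α 0
  | diamond (i : ℕ) (hi : (i : ℕ∞) ≤ α) : NotationFunc α 1

/-- Relation symbols of the signature `(≺, Λ, ⟨◇ᵢ ∣ i ∈ ω, i ≤ α⟩)`. -/
inductive NotationRel : ℕ → Type
  | prec : NotationRel 2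

/-- The signature `(≺, Λ, ⟨◇ᵢ ∣ i ∈ ω, i ≤ α⟩)`. -/
def notationLanguage (α : ℕ∞) : FirstOrder.Language.{0, 0} :=
  ⟨NotationFunc α, NotationRel⟩

/-- The structure `(W_α^N, ≺, Λ, ⟨◇ᵢ ∣ i ∈ ω, i ≤ α⟩)`. -/
noncomputable instance (α : ℕ∞) : (notationLanguage α).Structure (WN α) where
  funMap := fun {_} f =>
    match f with
    | NotationFunc.empty => fun _ => WN.empty α
    | NotationFunc.diamond i hi => fun x => WN.diamond i hi (x 0)
  RelMap := fun {_} R =>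
    match R with
    | NotationRel.prec => fun x => Prec (x 0).1 (x 1).1

/-! ### Gödel numbering of sentences and decidability of theories -/

/-- Gödel numbers of terms. -/
def termCode {α : ℕ∞} {n : ℕ} : (notationLanguage α).Term (Empty ⊕ Fin n) → ℕ
  | .var (Sum.inr k) => Nat.pair 0 k
  | .func NotationFunc.empty _ => Nat.pair 1 0
  | .func (NotationFunc.diamond i _) ts => Nat.pair 2 (Nat.pair i (termCode (ts 0)))

/-- Gödel numbers of formulas. -/
def formulaCode {α : ℕ∞} : {n : ℕ} → (notationLanguage α).BoundedFormula Empty n → ℕ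
  | _, .falsum => Nat.pair 0 0
  | _, .equal t u => Nat.pair 1 (Nat.pair (termCode t) (termCode u))
  | _, .rel NotationRel.prec ts => Nat.pair 2 (Nat.pair (termCode (ts 0)) (termCode (ts 1)))
  | _, .imp φ ψ => Nat.pair 3 (Nat.pair (formulaCode φ) (formulaCode ψ))
  | _, .all φ => Nat.pair 4 (formulaCode φ)

theorem termCode_injective {α : ℕ∞} {n : ℕ} :
    Function.Injective (termCode (α := α) (n := n)) := by
  intro t
  induction t with
  | var a =>
    rcases a with a | k
    · exact a.elim
    intro u h
    match u with
    | .var (Sum.inr k') => simpa [termCode, Fin.ext_iff] using h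
    | .func NotationFunc.empty _ => simp [termCode] at h
    | .func (NotationFunc.diamond i _) ts => simp [termCode] at h
  | func f ts ih =>
    intro u h
    cases f with
    | empty =>
      match u with
      | .var (Sum.inr k') => simp [termCode] at h
      | .func NotationFunc.empty us =>
        congr 1
        exact funext fun i => i.elim0
      | .func (NotationFunc.diamond i _) us => simp [termCode] at h
    | diamond i hi =>
      match u with
      | .var (Sum.inr k') => simp [termCode] at h
      | .func NotationFunc.empty us => simp [termCode] at h
      | .func (NotationFunc.diamond j hj) us =>
        simp only [termCode, Nat.pair_eq_pair, true_and] at h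
        obtain ⟨rfl, h⟩ := h
        congr 1
        funext k
        rw [Subsingleton.elim k 0]
        exact ih 0 h

theorem formulaCode_injective {α : ℕ∞} {n : ℕ} :
    Function.Injective (formulaCode (α := α) (n := n)) := by
  intro φ
  induction φ with
  | falsum =>
    intro ψ h
    match ψ with
    | .falsum => rfl
    | .equal _ _ => simp [formulaCode] at h
    | .rel NotationRel.prec _ => simp [formulaCode] at h
    | .imp _ _ => simp [formulaCode] at h
    | .all _ => simp [formulaCode] at h
  | equal t u =>
    intro ψ h
    match ψ with
    | .falsum => simp [formulaCode] at h
    | .equal t' u' =>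
      simp only [formulaCode, Nat.pair_eq_pair, true_and] at h
      rw [termCode_injective h.1, termCode_injective h.2]
    | .rel NotationRel.prec _ => simp [formulaCode] at h
    | .imp _ _ => simp [formulaCode] at h
    | .all _ => simp [formulaCode] at h
  | rel R ts =>
    intro ψ h
    cases R with
    | prec =>
      match ψ with
      | .falsum => simp [formulaCode] at h
      | .equal _ _ => simp [formulaCode] at h
      | .rel NotationRel.prec us =>
        simp only [formulaCode, Nat.pair_eq_pair, true_and] at h
        congr 1
        funext k
        match k with
        | 0 => exact termCode_injective h.1
        | 1 => exact termCode_injective h.2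
      | .imp _ _ => simp [formulaCode] at h
      | .all _ => simp [formulaCode] at h
  | imp φ₁ φ₂ ih₁ ih₂ =>
    intro ψ h
    match ψ with
    | .falsum => simp [formulaCode] at h
    | .equal _ _ => simp [formulaCode] at h
    | .rel NotationRel.prec _ => simp [formulaCode] at h
    | .imp _ _ =>
      simp only [formulaCode, Nat.pair_eq_pair, true_and] at h
      rw [ih₁ h.1, ih₂ h.2]
    | .all _ => simp [formulaCode] at h
  | all φ ih =>
    intro ψ h
    match ψ with
    | .falsum => simp [formulaCode] at h
    | .equal _ _ => simp [formulaCode] at h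
    | .rel NotationRel.prec _ => simp [formulaCode] at h
    | .imp _ _ => simp [formulaCode] at h
    | .all _ =>
      simp only [formulaCode, Nat.pair_eq_pair, true_and] at h
      rw [ih h]

/-- A theory is decidable if the set of Gödel numbers of its sentences is computable. -/
def IsDecidableTheory {α : ℕ∞} (T : (notationLanguage α).Theory) : Prop :=
  ComputablePred fun c : ℕ => ∃ φ ∈ T, formulaCode φ = c

end WordNotation

/-! A normal form without symbols below `n` is a non-increasing list of blocks with symbols above
`n`, and `≾` is the lexicographic order of these lists (`join_le_join`). On such lists `◇ₙ` appends
the empty block, so it is a successor operation, while `◇ᵢ` with `i > n` applies `◇ᵢ` to the last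
block and erases the earlier blocks that are smaller than the result (`dia_join`).

Consequently `y ≤ w < ◇₁ y` says that the level-0 list of `y` is an initial segment of that of `w`
(`prefix_of_lt_dia_one`, `lt_dia_one_of_prefix`), so one word codes a finite list, and `◇₃ y` serves
as a label of the last block of `y`. Given `r`, take the base `D = step r 0 = 3^r 2 … 2 3 2` and let
the number `n` be `◇₃` applied `n + 1` times to `D`. The words `step r i`, whose level-2 lists are
initial segments of that of `D`, lie below all numbers, yet `◇₃` sends `step r i` to the number `i`.
A pair `i ≤ j` is coded by the block `step r i 1 step r j`: under `◇₃` this block and everything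
before it collapse to the number `j` (`dia_three_join_block`), and `i` is recovered by approaching
the block from below with the help of `◇₂` (`dia_three_eq_top`). Hence every binary relation on `{0,
…, r}` has a code (`exists_base`).

The numbers over `D` are definable: `Num` asks for a listed set of labels in which every element is
`◇₃ D` or `◇₃` of another element. Such a set is finite and `◇₃` is strictly increasing, so it
consists of genuine iterates, whatever `D` is (`Num.exists_eq`). This leads to the one-sided notion
`Good`: the defining formula is sound over every `D` and complete over all sufficiently large bases.
It is not claimed for negations, but it is preserved by existential and bounded universal
quantifiers and, since finite sequences of numbers are coded as relations, by iteration
(`Good.iter`). Addition, multiplication, pairing and the graphs of all partial recursive functions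
follow (`good_eval`).

Halting on input `n` thus becomes the existence of some `D` with `P D (◇₃ … ◇₃ D)`, a property whose
negation is a sentence computable from `n`. A decision procedure for the theory would solve the
halting problem. -/

namespace WordNotation

/-! ### Lexicographically ordered lists -/

section Lists

variable {T : Type*} [LinearOrder T]

theorem list_cons_le_cons_iff {a b : T} {l m : List T} :
    a :: l ≤ b :: m ↔ a < b ∨ a = b ∧ l ≤ m := by
  rw [← not_lt, List.cons_lt_cons_iff, ← not_lt (a := m)]
  rcases lt_trichotomy a b with h | rfl | h
  · simp [h, h.not_gt, h.ne']
  · simp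
  · simp [h, h.not_gt, h.ne']

/-- Append `c` to a non-increasing list, dropping the entries smaller than `c`. -/
def adjoin (l : List T) (c : T) : List T := l.takeWhile (fun a => decide (c ≤ a)) ++ [c]

theorem adjoin_nil (c : T) : adjoin [] c = [c] := rfl

theorem adjoin_cons_of_le {a c : T} (h : c ≤ a) (l : List T) :
    adjoin (a :: l) c = a :: adjoin l c := by
  simp [adjoin, h]

theorem adjoin_cons_of_lt {a c : T} (h : a < c) (l : List T) : adjoin (a :: l) c = [c] := by
  simp [adjoin, h]

theorem adjoin_of_forall_lt {c : T} {l : List T} (h : ∀ a ∈ l, a < c) : adjoin l c = [c] := by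
  cases l with
  | nil => rfl
  | cons a l => exact adjoin_cons_of_lt (h a (by simp)) l

theorem adjoin_of_forall_le {c : T} {l : List T} (h : ∀ a ∈ l, c ≤ a) : adjoin l c = l ++ [c] := by
  induction l with
  | nil => rfl
  | cons a l ih =>
    rw [adjoin_cons_of_le (h a (by simp)), ih fun b hb => h b (by simp [hb]), List.cons_append]

theorem adjoin_append {c : T} {l m : List T} (h : ∀ a ∈ l, c ≤ a) :
    adjoin (l ++ m) c = l ++ adjoin m c := by
  induction l with
  | nil => rfl
  | cons a l ih =>
    rw [List.cons_append, adjoin_cons_of_le (h a (by simp)), ih fun b hb => h b (by simp [hb]),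
      List.cons_append]

theorem mem_adjoin {c x : T} {l : List T} (h : x ∈ adjoin l c) : x ∈ l ∨ x = c := by
  rcases List.mem_append.1 h with h | h
  · exact Or.inl ((List.takeWhile_sublist _).subset h)
  · exact Or.inr (by simpa using h)

theorem adjoin_ne_nil (l : List T) (c : T) : adjoin l c ≠ [] := by simp [adjoin]

theorem pairwise_adjoin {c : T} {l : List T} (h : l.Pairwise (· ≥ ·)) :
    (adjoin l c).Pairwise (· ≥ ·) := by
  refine List.pairwise_append.2 ⟨h.sublist (List.takeWhile_sublist _), by simp, ?_⟩
  intro a ha b hb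
  rw [List.mem_singleton.1 hb]
  simpa using List.mem_takeWhile_imp ha

/-- The lists first differ where `c` lands, either at the first entry of `l` below `c` or at the
place of `x`. The tail `m` never matters. -/
theorem append_lt_adjoin {x c : T} (h : x < c) (l m : List T) : l ++ x :: m < adjoin l c := by
  induction l with
  | nil => exact List.cons_lt_cons_iff.2 (Or.inl h)
  | cons a l ih =>
    rcases le_or_gt c a with h1 | h1
    · rw [adjoin_cons_of_le h1, List.cons_append, List.cons_lt_cons_iff]
      exact Or.inr ⟨rfl, ih⟩
    · rw [adjoin_cons_of_lt h1, List.cons_append, List.cons_lt_cons_iff]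
      exact Or.inl h1

theorem adjoin_le_singleton {b c : T} {l : List T} (h : ∀ a ∈ l, a < b) (hc : c ≤ b) :
    adjoin l c ≤ [b] := by
  have hcb : [c] ≤ [b] := by
    rw [list_cons_le_cons_iff]
    exact hc.lt_or_eq.imp id fun h => ⟨h, le_rfl⟩
  cases l with
  | nil => exact hcb
  | cons a l =>
    rcases le_or_gt c a with h1 | h1
    · rw [adjoin_cons_of_le h1]
      exact (List.cons_lt_cons_iff.2 (Or.inl (h a (by simp)))).le
    · rw [adjoin_cons_of_lt h1]
      exact hcb

theorem singleton_le_cons (a : T) (l : List T) : [a] ≤ a :: l := by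
  rw [list_cons_le_cons_iff]
  refine Or.inr ⟨rfl, ?_⟩
  cases l with
  | nil => exact le_rfl
  | cons b l => exact (List.nil_lt_cons b l).le

theorem append_lt_append_iff (l : List T) {m k : List T} : l ++ m < l ++ k ↔ m < k := by
  induction l with
  | nil => rfl
  | cons a l ih => simp [ih]

theorem append_le_append_iff (l : List T) {m k : List T} : l ++ m ≤ l ++ k ↔ m ≤ k := by
  rw [← not_lt, ← not_lt, append_lt_append_iff]

theorem lt_append_singleton (l : List T) (c : T) : l < l ++ [c] := by
  have := (append_lt_append_iff l (m := []) (k := [c])).2 (List.nil_lt_cons c [])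
  simpa using this

/-- `l ++ [b]` is the successor of `l` if `b` is the least element. -/
theorem le_of_lt_append_singleton {b : T} (hb : ∀ x, b ≤ x) {l m : List T} (h : m < l ++ [b]) :
    m ≤ l := by
  induction l generalizing m with
  | nil =>
    cases m with
    | nil => exact le_rfl
    | cons a m =>
      rw [List.nil_append, List.cons_lt_cons_iff] at h
      rcases h with h | ⟨_, h⟩
      · exact absurd h (hb a).not_gt
      · exact absurd h (List.not_lt_nil m)
  | cons a l ih =>
    cases m with
    | nil => exact (List.nil_lt_cons a l).le
    | cons c m =>
      rw [List.cons_append, List.cons_lt_cons_iff] at h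
      rw [list_cons_le_cons_iff]
      exact h.imp id fun h => ⟨h.1, ih h.2⟩

/-- If `c` is the successor of the last entry `x` of `l ++ [x]`, then every non-increasing list in
the interval `[l ++ [x], adjoin l c)` extends `l ++ [x]`. -/
theorem prefix_of_lt_adjoin {x c : T} {l k : List T} (hcl : ∀ y ∈ l, y < c → y ≤ x)
    (hck : ∀ y ∈ k, y < c → y ≤ x) (hl : (l ++ [x]).Pairwise (· ≥ ·)) (hk : k.Pairwise (· ≥ ·))
    (h1 : l ++ [x] ≤ k)
    (h2 : k < adjoin l c) : (l ++ [x]) <+: k := by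
  induction l generalizing k with
  | nil =>
    cases k with
    | nil => exact absurd (List.nil_lt_cons x []) h1.not_gt
    | cons a k =>
      rw [adjoin_nil, List.cons_lt_cons_iff] at h2
      rw [List.nil_append, list_cons_le_cons_iff] at h1
      have hax : a ≤ x := by
        rcases h2 with h | h
        · exact hck a (by simp) h
        · exact absurd h.2 (List.not_lt_nil k)
      have : x = a := by
        rcases h1 with h | h
        · exact absurd h hax.not_gt
        · exact h.1
      exact ⟨k, by simp [this]⟩
  | cons a l ih =>
    rw [List.cons_append, List.pairwise_cons] at hl
    cases k with
    | nil => exact absurd (List.nil_lt_cons a _) h1.not_gt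
    | cons b k =>
      rw [List.pairwise_cons] at hk
      have hcl' : ∀ y ∈ l, y < c → y ≤ x := fun y hy => hcl y (by simp [hy])
      have hck' : ∀ y ∈ k, y < c → y ≤ x := fun y hy => hck y (by simp [hy])
      rw [List.cons_append, list_cons_le_cons_iff] at h1
      rcases le_or_gt c a with h3 | h3
      · rw [adjoin_cons_of_le h3, List.cons_lt_cons_iff] at h2
        have hab : a = b := by
          rcases h1 with h | h
          · rcases h2 with h' | h'
            · exact absurd h h'.not_gt
            · exact absurd h'.1 h.ne'
          · exact h.1
        subst hab
        simp only [lt_irrefl, false_or, true_and] at h1 h2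
        simpa using ih hcl' hck' hl.2 hk.2 h1 h2
      · rw [adjoin_cons_of_lt h3, List.cons_lt_cons_iff] at h2
        have hxa : x ≤ a := hl.1 x (by simp)
        have hax : a = x := le_antisymm (hcl a (by simp) h3) hxa
        have hbc : b < c := by
          rcases h2 with h | h
          · exact h
          · exact absurd h.2 (List.not_lt_nil k)
        have hab : a = b := by
          rcases h1 with h | h
          · exact absurd h ((hck b (by simp) hbc).trans hxa).not_gt
          · exact h.1
        subst hab
        simp only [lt_irrefl, false_or, true_and] at h1
        -- Here `c` erases the whole of `l`, and the entries of `k` are at most `a < c`; so the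
        -- hypothesis passes to the tails.
        have h4 : k < adjoin l c := by
          have hlc : adjoin l c = [c] :=
            adjoin_of_forall_lt fun y hy => (hl.1 y (by simp [hy])).trans_lt h3
          rw [hlc]
          cases k with
          | nil => exact List.nil_lt_cons _ _
          | cons d k =>
            exact List.cons_lt_cons_iff.2 (Or.inl ((hk.1 d (by simp)).trans_lt h3))
        simpa using ih hcl' hck' hl.2 hk.2 h1 h4

/-- The lists in the interval `[l ++ [a], l ++ [b])`. -/
theorem exists_of_mem_Ico {a b : T} {l m : List T} (h1 : l ++ [a] ≤ m) (h2 : m < l ++ [b]) :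
    ∃ e r, m = l ++ e :: r ∧ a ≤ e ∧ e < b := by
  induction l generalizing m with
  | nil =>
    cases m with
    | nil => exact absurd (List.nil_lt_cons a []) h1.not_gt
    | cons e r =>
      refine ⟨e, r, rfl, ?_, ?_⟩
      · rw [List.nil_append, list_cons_le_cons_iff] at h1
        rcases h1 with h | h
        · exact h.le
        · exact h.1.le
      · rw [List.nil_append, List.cons_lt_cons_iff] at h2
        rcases h2 with h | h
        · exact h
        · exact absurd h.2 (List.not_lt_nil r)
  | cons x l ih =>
    cases m with
    | nil => exact absurd (List.nil_lt_cons x _) h1.not_gt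
    | cons y m =>
      rw [List.cons_append, list_cons_le_cons_iff] at h1
      rw [List.cons_append, List.cons_lt_cons_iff] at h2
      have hxy : x = y := by
        rcases h1 with h | h
        · rcases h2 with h' | h'
          · exact absurd h h'.not_gt
          · exact absurd h'.1 h.ne'
        · exact h.1
      subst hxy
      simp only [lt_irrefl, false_or, true_and] at h1 h2
      obtain ⟨e, r, rfl, h⟩ := ih h1 h2
      exact ⟨e, r, rfl, h⟩

end Lists


/-! ### Normal forms as lists of normal forms -/

/-- The words in normal form. -/
@[ext] structure NW where
  /-- The underlying word. -/
  word : Word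
  isNF : NF word

theorem precsim_refl (A : Word) : Precsim A A := linPre_precsim.refl trivial

theorem precsim_trans {A B C : Word} (h : Precsim A B) (h' : Precsim B C) : Precsim A C :=
  linPre_precsim.trans A B C trivial trivial trivial h h'

namespace NW

noncomputable instance : LinearOrder NW where
  le x y := Precsim x.1 y.1
  lt x y := Prec x.1 y.1
  le_refl x := precsim_refl x.1
  le_trans _ _ _ h h' := precsim_trans h h'
  le_antisymm x y h h' := NW.ext ((existsUnique_nf x.1).unique
    ⟨x.2, precsim_refl _, precsim_refl _⟩ ⟨y.2, h, h'⟩)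
  le_total x y := linPre_precsim.total x.1 y.1 trivial trivial
  toDecidableLE := Classical.decRel _
  lt_iff_le_not_ge _ _ := Iff.rfl

/-- The normal form of a word. -/
noncomputable def nf (A : Word) : NW := ⟨normalForm A, (normalForm_spec A).1⟩

theorem nf_eq_of_sim {A : Word} {x : NW} (h : Sim A x.1) : nf A = x :=
  NW.ext ((existsUnique_nf A).unique (normalForm_spec A) ⟨x.2, h⟩)

theorem nf_val (x : NW) : nf x.1 = x := nf_eq_of_sim ⟨precsim_refl _, precsim_refl _⟩

theorem nf_val_of_nf {A : Word} (h : NF A) : (nf A).1 = A := congrArg NW.word (nf_val ⟨A, h⟩)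

theorem sim_nf (A : Word) : Sim A (nf A).1 := (normalForm_spec A).2

/-- All symbols of the word are at least `n`. -/
def Ge (n : ℕ) (x : NW) : Prop := ∀ s ∈ x.1, n ≤ s

theorem Ge.mono {m n : ℕ} {x : NW} (h : Ge n x) (hmn : m ≤ n) : Ge m x :=
  fun s hs => hmn.trans (h s hs)

theorem ge_zero (x : NW) : Ge 0 x := fun _ _ => Nat.zero_le _

/-- The list of the blocks of a word in normal form that has no symbols below `n`. -/
structure Valid (n : ℕ) (l : List NW) : Prop where
  ne_nil : l ≠ []
  sorted : l.Pairwise (· ≥ ·)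
  ge : ∀ x ∈ l, Ge (n + 1) x

/-- The word `A₁ n A₂ n … n Aₖ`. -/
noncomputable def join (n : ℕ) (l : List NW) : NW := nf ([n].intercalate (l.map NW.word))

theorem Valid.join_val {n : ℕ} {l : List NW} (h : Valid n l) :
    (join n l).1 = [n].intercalate (l.map NW.word) := by
  refine nf_val_of_nf ?_
  by_cases h2 : 2 ≤ l.length
  · refine NF.join n _ (by simpa using h2) ?_ ?_ ?_
    · intro A hA x hx
      obtain ⟨a, ha, rfl⟩ := List.mem_map.1 hA
      exact h.ge a ha x hx
    · exact List.Pairwise.isChain (List.pairwise_map.2 h.sorted)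
    · intro A hA
      obtain ⟨a, ha, rfl⟩ := List.mem_map.1 hA
      exact a.2
  · have h1 : l.length = 1 := by
      have := List.length_pos_of_ne_nil h.ne_nil
      omega
    obtain ⟨x, rfl⟩ := List.length_eq_one_iff.1 h1
    simpa using x.2

theorem splitOn_intercalate_map {n : ℕ} {L : List Word} (h0 : L ≠ [])
    (h : ∀ A ∈ L, ∀ s ∈ A, n + 1 ≤ s) : ([n].intercalate L).splitOn n = L :=
  List.splitOn_intercalate n (fun A hA hn => by have := h A hA n hn; omega) h0

theorem le_of_mem_intercalate {n : ℕ} {L : List Word} (h : ∀ A ∈ L, ∀ s ∈ A, n + 1 ≤ s) :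
    ∀ s ∈ [n].intercalate L, n ≤ s := by
  intro s hs
  rcases mem_intercalate hs with h1 | ⟨A, hA, h1⟩
  · exact h1.1.ge
  · have := h A hA s h1
    omega

theorem Valid.map_ge {n : ℕ} {l : List NW} (h : Valid n l) :
    ∀ A ∈ l.map NW.word, ∀ s ∈ A, n + 1 ≤ s := by
  intro A hA s hs
  obtain ⟨a, ha, rfl⟩ := List.mem_map.1 hA
  exact h.ge a ha s hs

theorem Valid.splitOn {n : ℕ} {l : List NW} (h : Valid n l) :
    (join n l).1.splitOn n = l.map NW.word := by
  rw [h.join_val]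
  exact splitOn_intercalate_map (by simpa using h.ne_nil) h.map_ge

theorem Valid.join_ge {n : ℕ} {l : List NW} (h : Valid n l) : Ge n (join n l) := by
  intro s hs
  rw [h.join_val] at hs
  exact le_of_mem_intercalate h.map_ge s hs

theorem Valid.isLexMax {n : ℕ} {l : List NW} (h : Valid n l) :
    IsLexMax Precsim (l.map NW.word) ((join n l).1.splitOn n) := by
  rw [h.splitOn]
  exact linPre_precsim.isLexMax_of_pairwise (fun _ _ => trivial) (List.pairwise_map.2 h.sorted)

theorem exists_join {n : ℕ} {x : NW} (h : Ge n x) : ∃ l, Valid n l ∧ join n l = x := by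
  have h1 := x.2.splitOn h
  have h2 : ∃ l : List NW, l.map NW.word = x.1.splitOn n := by
    have : ∀ L : List Word, (∀ A ∈ L, NF A) → ∃ l : List NW, l.map NW.word = L := fun L hL =>
      ⟨L.attach.map fun A => ⟨A.1, hL A.1 A.2⟩, by simp⟩
    exact this _ h1.2
  obtain ⟨l, hl⟩ := h2
  refine ⟨l, ⟨?_, ?_, ?_⟩, ?_⟩
  · rintro rfl
    simp at hl
  · rw [← hl] at h1
    exact (List.pairwise_map (R := fun A B => Precsim B A)).1 h1.1
  · intro y hy s hs
    have h3 : y.1 ∈ x.1.splitOn n := hl ▸ List.mem_map_of_mem hy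
    have h4 := mem_of_mem_splitOn h3 hs
    have := h s h4.1
    omega
  · rw [join, hl, List.intercalate_splitOn, nf_val]

/-- On normal forms `∼` is equality, so the comparison of sequences up to `∼` is the ordinary
lexicographic order. -/
theorem lexLE_map_iff {l m : List NW} :
    LexLE Precsim (l.map NW.word) (m.map NW.word) ↔ l ≤ m := by
  induction l generalizing m with
  | nil => simpa [LexLE] using not_lt.1 (List.not_lt_nil m)
  | cons a l ih =>
    cases m with
    | nil => simp [LexLE]
    | cons b m =>
      have h1 : (Precsim a.1 b.1 ∧ ¬ Precsim b.1 a.1) ↔ a < b := Iff.rfl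
      have h2 : (Precsim a.1 b.1 ∧ Precsim b.1 a.1) ↔ a = b :=
        (le_antisymm_iff (a := a) (b := b)).symm
      rw [list_cons_le_cons_iff, ← ih, List.map_cons, List.map_cons, LexLE, h1, ← h2]
      tauto

/-- A non-increasing list is its own lexicographically maximal subsequence. This reduces every later
comparison of words to lists. -/
theorem join_le_join {n : ℕ} {l m : List NW} (hl : Valid n l) (hm : Valid n m) :
    join n l ≤ join n m ↔ l ≤ m := by
  have T : ∀ L : List Word, ∀ a ∈ L, True := fun _ _ _ => trivial
  rw [← lexLE_map_iff]
  refine (precsim_iff_of_ge hl.join_ge hm.join_ge).trans ⟨?_, fun h => ?_⟩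
  · rintro ⟨C, D, hC, hD, h⟩
    exact linPre_precsim.lex_trans (T _) (T _) (T _) (hC.2 _ hl.isLexMax.1)
      (linPre_precsim.lex_trans (T _) (T _) (T _) h (hm.isLexMax.2 _ hD.1))
  · exact ⟨_, _, hl.isLexMax, hm.isLexMax, h⟩

theorem join_lt_join {n : ℕ} {l m : List NW} (hl : Valid n l) (hm : Valid n m) :
    join n l < join n m ↔ l < m := by
  rw [← not_le, join_le_join hm hl, not_le]

theorem join_singleton (n : ℕ) (x : NW) : join n [x] = x := by
  simpa [join] using nf_val x

theorem valid_singleton {n : ℕ} {x : NW} (h : Ge (n + 1) x) : Valid n [x] :=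
  ⟨by simp, by simp, by simpa using h⟩

/-- The empty word. -/
def nil : NW := ⟨[], NF.nil⟩

theorem nil_ge (n : ℕ) : Ge n nil := fun s hs => by simp [nil] at hs

theorem nil_le (x : NW) : nil ≤ x := by
  obtain ⟨r, hr⟩ := exists_inRange x.1
  -- Induction on the number of available symbols: the blocks of `x` use one symbol fewer, and the
  -- first block alone already decides.
  suffices ∀ r n, ∀ x : NW, InRange n r x.1 → nil ≤ x from this r 0 x (hr r le_rfl)
  intro r
  induction r with
  | zero =>
    intro n x hx
    have : x.1 = [] := by
      rw [List.eq_nil_iff_forall_not_mem]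
      intro s hs
      have := hx s hs
      omega
    exact (NW.ext this : x = nil).ge
  | succ r ih =>
    intro n x hx
    obtain ⟨l, hl, rfl⟩ := exists_join (n := n) (x := x) fun s hs => (hx s hs).1
    rw [← join_singleton n nil, join_le_join (valid_singleton (nil_ge _)) hl]
    cases l with
    | nil => exact absurd rfl hl.ne_nil
    | cons a l =>
      refine le_trans ?_ (singleton_le_cons a l)
      rw [list_cons_le_cons_iff]
      refine (ih (n + 1) a ?_).lt_or_eq.imp id fun h => ⟨h, le_rfl⟩
      refine hx.splitOn a.1 ?_
      rw [hl.splitOn]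
      simp

theorem Valid.append_nil {n : ℕ} {l : List NW} (h : Valid n l) : Valid n (l ++ [nil]) := by
  refine ⟨by simp, List.pairwise_append.2 ⟨h.sorted, by simp, ?_⟩, ?_⟩
  · intro a _ b hb
    rw [List.mem_singleton.1 hb]
    exact nil_le a
  · intro a ha
    rcases List.mem_append.1 ha with ha | ha
    · exact h.ge a ha
    · rw [List.mem_singleton.1 ha]
      exact nil_ge _

/-! ### The operators `◇ᵢ` on lists of blocks -/

/-- The operator `◇ᵢ`. -/
noncomputable def dia (i : ℕ) (x : NW) : NW := nf (x.1 ++ [i])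

theorem dia_ge {n i : ℕ} {x : NW} (h : Ge n x) (hi : n ≤ i) : Ge n (dia i x) := by
  intro s hs
  rcases List.mem_append.1 (normalForm_subset _ hs) with h1 | h1
  · exact h s h1
  · rw [List.mem_singleton.1 h1]
    exact hi

theorem intercalate_append_singleton (n : ℕ) {L : List Word} (h : L ≠ []) (A : Word) :
    [n].intercalate (L ++ [A]) = [n].intercalate L ++ n :: A := by
  induction L with
  | nil => exact absurd rfl h
  | cons B L ih =>
    cases L with
    | nil => simp
    | cons C L =>
      have := ih (by simp)
      simp only [List.cons_append] at this
      simp only [List.cons_append, List.intercalate_cons_cons, this, List.append_assoc]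

/-- A final `n` opens a new empty block, which as the least block keeps the list non-increasing. -/
theorem dia_join_self {n : ℕ} {l : List NW} (h : Valid n l) :
    dia n (join n l) = join n (l ++ [nil]) := by
  rw [dia, h.join_val, join, List.map_append, List.map_singleton,
    intercalate_append_singleton n (by simpa using h.ne_nil)]
  rfl

theorem intercalate_append_append (n : ℕ) (L : List Word) (A : Word) (i : ℕ) :
    [n].intercalate (L ++ [A]) ++ [i] = [n].intercalate (L ++ [A ++ [i]]) := by
  by_cases h : L = []
  · simp [h]
  · simp [intercalate_append_singleton n h]

theorem Valid.adjoin {n : ℕ} {l : List NW} (h : l.Pairwise (· ≥ ·)) (h' : ∀ x ∈ l, Ge (n + 1) x)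
    {c : NW} (hc : Ge (n + 1) c) : Valid n (adjoin l c) := by
  refine ⟨adjoin_ne_nil l c, pairwise_adjoin h, fun x hx => ?_⟩
  rcases mem_adjoin hx with hx | rfl
  · exact h' x hx
  · exact hc

theorem Valid.of_append {n : ℕ} {l : List NW} {x : NW} (h : Valid n (l ++ [x])) :
    l.Pairwise (· ≥ ·) ∧ (∀ y ∈ l, Ge (n + 1) y) ∧ Ge (n + 1) x ∧ ∀ y ∈ l, x ≤ y :=
  ⟨(List.pairwise_append.1 h.sorted).1, fun y hy => h.ge y (by simp [hy]), h.ge x (by simp),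
    fun y hy => (List.pairwise_append.1 h.sorted).2.2 y hy x (by simp)⟩

/-- `K` is the part of `L` that is not below `B`; skipping the smaller rest `M` lets `B` appear
earlier, which is better lexicographically. -/
theorem isLexMax_append {L : List Word} (hL : L.Pairwise (fun A B => Precsim B A)) (B : Word)
    {K : List Word} (hK : ∃ M, L = K ++ M ∧ (∀ A ∈ K, Precsim B A) ∧ ∀ A ∈ M, ¬ Precsim B A) :
    IsLexMax Precsim (K ++ [B]) (L ++ [B]) := by
  obtain ⟨M, rfl, h1, h2⟩ := hK
  refine ⟨by simp, ?_⟩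
  induction K with
  | nil =>
    intro D hD
    obtain ⟨D₁, D₂, rfl, hD₁, hD₂⟩ := List.sublist_append_iff.1 hD
    cases D₁ with
    | nil =>
      rcases List.sublist_singleton.1 hD₂ with rfl | rfl
      · simp [LexLE]
      · simp [LexLE, precsim_refl]
    | cons d D₁ =>
      have h3 := h2 d (by simpa using hD₁.subset (List.mem_cons_self ..))
      have h4 := linPre_precsim.total d B trivial trivial
      simp only [List.cons_append, List.nil_append, LexLE]
      tauto
  | cons a K ih =>
    intro D hD
    cases D with
    | nil => simp [LexLE]
    | cons d D =>
      rw [List.cons_append, List.pairwise_cons] at hL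
      have hD' : D.Sublist ((K ++ M) ++ [B]) := by simpa using hD.tail
      have ih := ih hL.2 (fun A hA => h1 A (by simp [hA])) D hD'
      have hBa := h1 a (by simp)
      have hd : d ∈ a :: (K ++ M) ∨ d = B := by
        have := hD.subset (List.mem_cons_self ..)
        simpa [or_assoc] using this
      have hda : Precsim d a := by
        rcases hd with hd | rfl
        · rcases List.mem_cons.1 hd with rfl | hd
          · exact precsim_refl _
          · exact hL.1 d hd
        · exact hBa
      simp only [List.cons_append, LexLE]
      tauto

theorem exists_takeWhile {l : List NW} (h : l.Pairwise (· ≥ ·)) (c : NW) :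
    ∃ m, l = l.takeWhile (fun a => decide (c ≤ a)) ++ m ∧ ∀ a ∈ m, a < c := by
  induction l with
  | nil => exact ⟨[], by simp⟩
  | cons a l ih =>
    rw [List.pairwise_cons] at h
    rcases le_or_gt c a with h1 | h1
    · obtain ⟨m, hm, hm'⟩ := ih h.2
      refine ⟨m, ?_, hm'⟩
      rw [List.takeWhile_cons_of_pos (by simpa using h1), List.cons_append, ← hm]
    · refine ⟨a :: l, ?_, ?_⟩
      · rw [List.takeWhile_cons_of_neg (by simpa using h1), List.nil_append]
      · intro b hb
        rcases List.mem_cons.1 hb with rfl | hb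
        · exact h1
        · exact (h.1 b hb).trans_lt h1

/-- A symbol `i > n` at the end of the word only lengthens the last block. Passing to the maximal
subsequence then deletes the blocks below the new last one. -/
theorem dia_join {n i : ℕ} (hi : n < i) {l : List NW} {x : NW} (h : Valid n (l ++ [x])) :
    dia i (join n (l ++ [x])) = join n (adjoin l (dia i x)) := by
  obtain ⟨hs, hge, hx, -⟩ := h.of_append
  have hc : Ge (n + 1) (dia i x) := dia_ge hx hi
  have hv : Valid n (adjoin l (dia i x)) := Valid.adjoin hs hge hc
  set B : Word := x.1 ++ [i] with hB
  have hBs : Sim B (dia i x).1 := sim_nf B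
  have hBge : ∀ s ∈ B, n + 1 ≤ s := by
    intro s hs
    rcases List.mem_append.1 hs with h1 | h1
    · exact hx s h1
    · rw [List.mem_singleton.1 h1]
      exact hi
  set L := l.map NW.word with hL
  set K := (l.takeWhile (fun a => decide (dia i x ≤ a))).map NW.word with hK
  have hge2 : ∀ A ∈ L ++ [B], ∀ s ∈ A, n + 1 ≤ s := by
    intro A hA
    rcases List.mem_append.1 hA with h1 | h1
    · obtain ⟨a, ha, rfl⟩ := List.mem_map.1 h1
      exact hge a ha
    · rw [List.mem_singleton.1 h1]
      exact hBge
  have hmax : IsLexMax Precsim (K ++ [B]) (([n].intercalate (L ++ [B])).splitOn n) := by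
    rw [splitOn_intercalate_map (by simp) hge2]
    refine isLexMax_append (List.pairwise_map.2 hs) B ?_
    obtain ⟨m, hm, hm'⟩ := exists_takeWhile hs (dia i x)
    refine ⟨m.map NW.word, ?_, ?_, ?_⟩
    · rw [← List.map_append]
      exact congrArg _ hm
    · intro A hA
      obtain ⟨a, ha, rfl⟩ := List.mem_map.1 hA
      have : dia i x ≤ a := by simpa using List.mem_takeWhile_imp ha
      exact precsim_trans hBs.1 this
    · intro A hA h1
      obtain ⟨a, ha, rfl⟩ := List.mem_map.1 hA
      exact (hm' a ha).2 (precsim_trans hBs.2 h1)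
  have hmax' := hv.isLexMax
  have hadj : (adjoin l (dia i x)).map NW.word = K ++ [(dia i x).1] := by
    rw [WordNotation.adjoin, List.map_append, List.map_singleton]
  rw [hadj] at hmax'
  have hF : ∀ {C D : Word}, Sim C D →
      List.Forall₂ (fun a b => Precsim a b ∧ Precsim b a) (K ++ [C]) (K ++ [D]) := by
    intro C D hCD
    refine List.rel_append (List.forall₂_same.2 fun A _ => ⟨precsim_refl A, precsim_refl A⟩) ?_
    exact .cons hCD .nil
  have e1 := lexLE_of_forall₂ (R := Precsim) (hF hBs)
  have e2 := lexLE_of_forall₂ (R := Precsim) (hF (C := (dia i x).1) (D := B) ⟨hBs.2, hBs.1⟩)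
  have hge3 := le_of_mem_intercalate hge2
  rw [dia, h.join_val, List.map_append, List.map_singleton, intercalate_append_append]
  exact nf_eq_of_sim ⟨(precsim_iff_of_ge hge3 hv.join_ge).2 ⟨_, _, hmax, hmax', e1⟩,
    (precsim_iff_of_ge hv.join_ge hge3).2 ⟨_, _, hmax', hmax, e2⟩⟩

theorem Valid.exists_append {n : ℕ} {l : List NW} (h : Valid n l) : ∃ m x, l = m ++ [x] :=
  ⟨l.dropLast, l.getLast h.ne_nil, (List.dropLast_append_getLast h.ne_nil).symm⟩

/-- Induction on `i - n`: at `i = n` the list gets longer; otherwise the last block grows, by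
induction with `n + 1` in place of `n`. -/
theorem lt_dia {n i : ℕ} (hi : n ≤ i) {x : NW} (h : Ge n x) : x < dia i x := by
  obtain ⟨k, rfl⟩ := Nat.exists_eq_add_of_le hi
  induction k generalizing n x with
  | zero =>
    obtain ⟨l, hl, rfl⟩ := exists_join h
    rw [add_zero, dia_join_self hl, join_lt_join hl hl.append_nil]
    exact lt_append_singleton l nil
  | succ k ih =>
    obtain ⟨l, hl, rfl⟩ := exists_join h
    obtain ⟨m, x, rfl⟩ := hl.exists_append
    obtain ⟨hs, hge, hx, -⟩ := hl.of_append
    have e : n + (k + 1) = n + 1 + k := by omega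
    have := ih (n := n + 1) hx (by omega)
    rw [← e] at this
    rw [dia_join (by omega) hl, join_lt_join hl (Valid.adjoin hs hge (dia_ge hx (by omega)))]
    exact append_lt_adjoin this m []

/-- `◇ₙ` is the successor on the words without symbols below `n`. -/
theorem le_of_lt_dia {n : ℕ} {x y : NW} (hx : Ge n x) (hy : Ge n y) (h : y < dia n x) : y ≤ x := by
  obtain ⟨l, hl, rfl⟩ := exists_join hx
  obtain ⟨m, hm, rfl⟩ := exists_join hy
  rw [dia_join_self hl, join_lt_join hm hl.append_nil] at h
  rw [join_le_join hm hl]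
  exact le_of_lt_append_singleton nil_le h

theorem dia_le_of_lt {n : ℕ} {x y : NW} (hx : Ge n x) (hy : Ge n y) (h : y < x) : dia n y ≤ x := by
  by_contra h1
  exact (le_of_lt_dia hy hx (not_le.1 h1)).not_gt h

/-- `y ≤ w < ◇₁ y` holds if and only if the list of `y` is an initial segment of the list of `w`;
this is the nontrivial direction. -/
theorem prefix_of_lt_dia_one {k l : List NW} (hk : Valid 0 k) (hl : Valid 0 l)
    (h1 : join 0 l ≤ join 0 k) (h2 : join 0 k < dia 1 (join 0 l)) : l <+: k := by
  obtain ⟨m, x, rfl⟩ := hl.exists_append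
  obtain ⟨hs, hge, hx, -⟩ := hl.of_append
  have hv : Valid 0 (adjoin m (dia 1 x)) := Valid.adjoin hs hge (dia_ge hx le_rfl)
  rw [dia_join (by omega) hl, join_lt_join hk hv] at h2
  rw [join_le_join hl hk] at h1
  have hsucc : ∀ y, Ge 1 y → y < dia 1 x → y ≤ x := fun y hy h => le_of_lt_dia hx hy h
  exact prefix_of_lt_adjoin (fun y hy => hsucc y (hge y hy)) (fun y hy => hsucc y (hk.ge y hy))
    hl.sorted hk.sorted h1 h2


/-! ### Initial segments -/

theorem Valid.of_prefix {n : ℕ} {k l : List NW} (hk : Valid n k) (h : l <+: k) (hl : l ≠ []) :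
    Valid n l :=
  ⟨hl, hk.sorted.sublist h.sublist, fun x hx => hk.ge x (h.subset hx)⟩

theorem exists_prefix_of_lt_dia_one {k : List NW} (hk : Valid 0 k) {y : NW} (h1 : y ≤ join 0 k)
    (h2 : join 0 k < dia 1 y) : ∃ l, l <+: k ∧ l ≠ [] ∧ y = join 0 l := by
  obtain ⟨l, hl, rfl⟩ := exists_join (ge_zero y)
  exact ⟨l, prefix_of_lt_dia_one hk hl h1 h2, hl.ne_nil, rfl⟩

/-- Converse of `prefix_of_lt_dia_one`: `◇₁` raises the block `x`, which beats any continuation `t`.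
-/
theorem lt_dia_one_of_prefix {m t : List NW} {x : NW} (hk : Valid 0 (m ++ x :: t)) :
    join 0 (m ++ [x]) ≤ join 0 (m ++ x :: t) ∧
      join 0 (m ++ x :: t) < dia 1 (join 0 (m ++ [x])) := by
  have hp : (m ++ [x]) <+: (m ++ x :: t) := ⟨t, by simp⟩
  have hl := hk.of_prefix hp (by simp)
  obtain ⟨hs, hge, hx, -⟩ := hl.of_append
  have hv : Valid 0 (adjoin m (dia 1 x)) := Valid.adjoin hs hge (dia_ge hx le_rfl)
  rw [dia_join (by omega) hl, join_lt_join hk hv, join_le_join hl hk]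
  exact ⟨(append_le_append_iff m).2 (singleton_le_cons x t),
    append_lt_adjoin (lt_dia le_rfl hx) m t⟩

/-- A list has finitely many initial segments. This finiteness excludes nonstandard elements from
`Num`. -/
theorem finite_initial (w : NW) : {y : NW | y ≤ w ∧ w < dia 1 y}.Finite := by
  obtain ⟨k, hk, rfl⟩ := exists_join (ge_zero w)
  refine ((List.finite_toSet k.inits).image (join 0)).subset ?_
  rintro y ⟨h1, h2⟩
  obtain ⟨l, hl, -, rfl⟩ := exists_prefix_of_lt_dia_one hk h1 h2
  exact ⟨l, by simpa using hl, rfl⟩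

/-! ### A ladder of words over `{2, 3}` -/

/-- The word `3 … 3` of length `m`. -/
noncomputable def three (m : ℕ) : NW := (dia 3)^[m] nil

theorem three_succ (m : ℕ) : dia 3 (three m) = three (m + 1) :=
  (Function.iterate_succ_apply' (dia 3) m nil).symm

theorem three_ge (m : ℕ) : Ge 3 (three m) := by
  induction m with
  | zero => exact nil_ge 3
  | succ m ih => exact three_succ m ▸ dia_ge ih le_rfl

theorem three_strictMono : StrictMono three :=
  strictMono_nat_of_lt_succ fun m => three_succ m ▸ lt_dia le_rfl (three_ge m)

/-- The blocks `3^r, 3^(r-1), …, 3^j`. -/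
noncomputable def stair (r j : ℕ) : List NW :=
  (List.range (r + 1 - j)).map fun i => three (r - i)

theorem stair_eq_nil {r j : ℕ} (h : r < j) : stair r j = [] := by
  simp [stair, Nat.sub_eq_zero_of_le h]

theorem stair_eq_append {r j : ℕ} (h : j ≤ r) : stair r j = stair r (j + 1) ++ [three j] := by
  have e : r + 1 - j = (r + 1 - (j + 1)) + 1 := by omega
  rw [stair, e, List.range_succ, List.map_append, List.map_singleton, stair]
  congr 4
  omega

theorem le_of_mem_stair {r j : ℕ} {x : NW} (h : x ∈ stair r j) : three j ≤ x := by
  obtain ⟨i, hi, rfl⟩ := List.mem_map.1 h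
  have := List.mem_range.1 hi
  exact three_strictMono.monotone (by omega)

theorem ge_of_mem_stair {r j : ℕ} {x : NW} (h : x ∈ stair r j) : Ge 3 x := by
  obtain ⟨i, -, rfl⟩ := List.mem_map.1 h
  exact three_ge _

theorem stair_sorted (r j : ℕ) : (stair r j).Pairwise (· ≥ ·) := by
  refine List.pairwise_map.2 (List.pairwise_lt_range.imp ?_)
  intro a b hab
  exact three_strictMono.monotone (by omega)

theorem valid_stair_append {r j k : ℕ} (h : k ≤ j) : Valid 2 (stair r j ++ [three k]) := by
  refine ⟨by simp, List.pairwise_append.2 ⟨stair_sorted r j, by simp, ?_⟩, ?_⟩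
  · intro a ha b hb
    rw [List.mem_singleton.1 hb]
    exact (three_strictMono.monotone h).trans (le_of_mem_stair ha)
  · intro a ha
    rcases List.mem_append.1 ha with ha | ha
    · exact ge_of_mem_stair ha
    · rw [List.mem_singleton.1 ha]
      exact three_ge k

/-- The word `3^r 2 3^(r-1) 2 … 2 3^j`. -/
noncomputable def step (r j : ℕ) : NW := join 2 (stair r (j + 1) ++ [three j])

/-- The word `3^r 2 3^(r-1) 2 … 2 3^(j+1) 2 3^(j+1)`. -/
noncomputable def top (r j : ℕ) : NW := join 2 (stair r (j + 1) ++ [three (j + 1)])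

theorem step_ge (r j : ℕ) : Ge 2 (step r j) := (valid_stair_append (by omega)).join_ge

theorem top_ge (r j : ℕ) : Ge 2 (top r j) := (valid_stair_append le_rfl).join_ge

/-- The last block `3^j` becomes `3^(j+1)`, and no earlier block is smaller than that. -/
theorem dia_step (r j : ℕ) : dia 3 (step r j) = top r j := by
  rw [step, dia_join (by omega) (valid_stair_append (by omega)), three_succ,
    adjoin_of_forall_le fun a ha => le_of_mem_stair ha, top]

theorem dia_top (r j : ℕ) : dia 3 (top r j) = top r (j + 1) := by
  rw [top, dia_join (by omega) (valid_stair_append le_rfl), three_succ, top]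
  congr 1
  rcases le_or_gt (j + 1) r with h | h
  -- The new block `3^(j+2)` erases just the final `3^(j+1)` of the stair; the block before it, if
  -- any, is again `3^(j+2)`.
  · rw [stair_eq_append h, adjoin_append fun a ha => le_of_mem_stair ha,
      adjoin_cons_of_lt (three_strictMono (by omega))]
  -- Once the stair is used up, the tops are plain powers of `3`.
  · rw [stair_eq_nil h, stair_eq_nil (by omega), adjoin_nil, List.nil_append]

/-- The list of `step r j` is one block longer. The steps decrease in `j` while their images `top r
j` increase, which is why pairs are coded with `i ≤ j`. -/
theorem step_succ_lt {r j : ℕ} (h : j < r) : step r (j + 1) < step r j := by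
  rw [step, step, ← stair_eq_append h, join_lt_join _ (valid_stair_append (by omega))]
  · exact lt_append_singleton _ _
  · rw [stair_eq_append h]
    exact valid_stair_append (by omega)

theorem step_le_step {r i j : ℕ} (hij : i ≤ j) (hj : j ≤ r) : step r j ≤ step r i := by
  induction j, hij using Nat.le_induction with
  | base => exact le_rfl
  | succ j _ ih => exact (step_succ_lt (by omega)).le.trans (ih (by omega))

theorem top_strictMono (r : ℕ) : StrictMono (top r) :=
  strictMono_nat_of_lt_succ fun j => by
    rw [← dia_top r j]
    exact lt_dia (n := 2) (by omega) (top_ge r j)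

theorem step_lt_top {r i : ℕ} (hi : i ≤ r) (j : ℕ) : step r i < top r j :=
  calc step r i ≤ step r 0 := step_le_step (Nat.zero_le i) hi
    _ < top r 0 := by
      rw [← dia_step r 0]
      exact lt_dia (n := 2) (by omega) (step_ge r 0)
    _ ≤ top r j := (top_strictMono r).monotone (Nat.zero_le j)

/-! ### Blocks that code pairs of numbers -/

/-- The block that codes the pair `(i, j)`. -/
noncomputable def block (r i j : ℕ) : NW := join 1 [step r i, step r j]

theorem valid_block {r i j : ℕ} (hij : i ≤ j) (hj : j ≤ r) :
    Valid 1 ([step r i] ++ [step r j]) :=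
  ⟨by simp, by simpa using step_le_step hij hj, by
    intro x hx
    rcases List.mem_append.1 hx with hx | hx <;> rw [List.mem_singleton.1 hx] <;>
      exact step_ge _ _⟩

theorem block_ge {r i j : ℕ} (hij : i ≤ j) (hj : j ≤ r) : Ge 1 (block r i j) :=
  (valid_block hij hj).join_ge

theorem block_lt {r i j : ℕ} (hij : i ≤ j) (hj : j ≤ r) {x : NW} (hx : Ge 2 x)
    (h : step r i < x) : block r i j < x := by
  rw [← join_singleton 1 x, block]
  exact (join_lt_join (valid_block hij hj) (valid_singleton hx)).2
    (List.cons_lt_cons_iff.2 (Or.inl h))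

theorem step_lt_block {r i j : ℕ} (hij : i ≤ j) (hj : j ≤ r) : step r i < block r i j := by
  rw [← join_singleton 1 (step r i), block]
  exact (join_lt_join (valid_singleton (step_ge r i)) (valid_block hij hj)).2
    (lt_append_singleton [step r i] (step r j))

/-- `◇₃` turns the second half into `top r j`, which exceeds every step and so erases the first
half. -/
theorem dia_three_block {r i j : ℕ} (hij : i ≤ j) (hj : j ≤ r) :
    dia 3 (block r i j) = top r j := by
  have : adjoin [step r i] (top r j) = [top r j] :=
    adjoin_cons_of_lt (step_lt_top (hij.trans hj) j) []
  rw [block]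
  exact (dia_join (by omega) (valid_block hij hj)).trans (by
    rw [dia_step, this, join_singleton])

/-- If `x` is less than the block of `(i, j)`, then `◇₂ x` is at most that block unless `x` is
the first half of the block. -/
theorem dia_two_le_block {r i j : ℕ} (hij : i ≤ j) (hj : j ≤ r) {x : NW} (hx : Ge 1 x)
    (h : x < block r i j) (hne : x ≠ step r i) : dia 2 x ≤ block r i j := by
  obtain ⟨g, hg, rfl⟩ := exists_join hx
  obtain ⟨g, y, rfl⟩ := hg.exists_append
  obtain ⟨hs, hge, hy, hle⟩ := hg.of_append
  have hb : Valid 1 [step r i, step r j] := valid_block hij hj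
  have hji := step_le_step hij hj
  have hv : Valid 1 (adjoin g (dia 2 y)) := Valid.adjoin hs hge (dia_ge hy le_rfl)
  rw [dia_join (by omega) hg, block, join_le_join hv hb]
  rw [block, join_lt_join hg hb] at h
  cases g with
  | nil =>
    have hlt : y < step r i := by
      rw [List.nil_append, List.cons_lt_cons_iff] at h
      rcases h with h | h
      · exact h
      · rw [h.1, List.nil_append, join_singleton] at hne
        exact absurd rfl hne
    rw [adjoin_nil, list_cons_le_cons_iff]
    refine (dia_le_of_lt (step_ge r i) hy hlt).lt_or_eq.imp id fun h => ⟨h, ?_⟩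
    exact (List.nil_lt_cons _ _).le
  | cons a g =>
    rw [List.cons_append, List.cons_lt_cons_iff] at h
    have hya := hle a (by simp)
    rw [List.pairwise_cons] at hs
    -- Either every entry lies below `step r i`, so `◇₂` cannot lift the list beyond `[step r i]`,
    -- or the first entry is `step r i` and all later ones lie below `step r j`, which bounds the
    -- rest in the same way.
    rcases h with h | ⟨rfl, h⟩
    · refine le_trans (adjoin_le_singleton (b := step r i) ?_ ?_) (singleton_le_cons _ _)
      · intro c hc
        rcases List.mem_cons.1 hc with rfl | hc
        · exact h
        · exact (hs.1 c hc).trans_lt h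
      · exact dia_le_of_lt (step_ge r i) hy (hya.trans_lt h)
    · have hsy := hg.sorted
      rw [List.cons_append, List.pairwise_cons] at hsy
      have hall : ∀ c ∈ g ++ [y], c < step r j := by
        cases hgy : g ++ [y] with
        | nil => simp
        | cons d g' =>
          rw [hgy, List.cons_lt_cons_iff] at h
          have hd : d < step r j := by
            rcases h with h | h
            · exact h
            · exact absurd h.2 (List.not_lt_nil g')
          rw [hgy] at hsy
          intro c hc
          rcases List.mem_cons.1 hc with rfl | hc
          · exact hd
          · exact ((List.pairwise_cons.1 hsy.2).1 c hc).trans_lt hd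
      have hc := dia_le_of_lt (step_ge r j) hy (hall y (by simp))
      rw [adjoin_cons_of_le (hc.trans hji)]
      rw [list_cons_le_cons_iff]
      exact Or.inr ⟨rfl, adjoin_le_singleton (fun c hc => hall c (by simp [hc])) hc⟩

/-- The entries of a list of blocks of pairs of numbers at most `r`. -/
def IsBlock (r : ℕ) (x : NW) : Prop := ∃ i j, i ≤ j ∧ j ≤ r ∧ x = block r i j

theorem IsBlock.lt_top {r : ℕ} {x : NW} (h : IsBlock r x) (j : ℕ) : x < top r j := by
  obtain ⟨i', j', h1, h2, rfl⟩ := h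
  exact block_lt h1 h2 (top_ge r j) (step_lt_top (h1.trans h2) j)

/-- A top exceeds all blocks, so the whole list collapses: the label of an initial segment depends
only on its last pair. -/
theorem dia_three_join_block {r i j : ℕ} (hij : i ≤ j) (hj : j ≤ r) {l : List NW}
    (hl : ∀ x ∈ l, IsBlock r x)
    (hv : Valid 0 (l ++ [block r i j])) :
    dia 3 (join 0 (l ++ [block r i j])) = top r j := by
  rw [dia_join (by omega) hv, dia_three_block hij hj,
    adjoin_of_forall_lt fun x hx => (hl x hx).lt_top j, join_singleton]

theorem valid_append_step {r i j : ℕ} (hij : i ≤ j) (hj : j ≤ r) {l : List NW}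
    (hv : Valid 0 (l ++ [block r i j])) :
    Valid 0 (l ++ [step r i]) := by
  obtain ⟨hs, hge, -, hle⟩ := hv.of_append
  refine ⟨by simp, List.pairwise_append.2 ⟨hs, by simp, ?_⟩, ?_⟩
  · intro a ha b hb
    rw [List.mem_singleton.1 hb]
    exact (step_lt_block hij hj).le.trans (hle a ha)
  · intro a ha
    rcases List.mem_append.1 ha with ha | ha
    · exact hge a ha
    · rw [List.mem_singleton.1 ha]
      exact (step_ge r i).mono (by omega)

theorem join_step_lt {r i j : ℕ} (hij : i ≤ j) (hj : j ≤ r) {l : List NW}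
    (hv : Valid 0 (l ++ [block r i j])) :
    join 0 (l ++ [step r i]) < join 0 (l ++ [block r i j]) := by
  rw [join_lt_join (valid_append_step hij hj hv) hv, append_lt_append_iff,
    List.cons_lt_cons_iff]
  exact Or.inl (step_lt_block hij hj)

/-- With `join_step_lt`, this makes the word with halved last block an admissible witness `z` in
`Fst`. -/
theorem lt_dia_two_join_step {r i j : ℕ} (hij : i ≤ j) (hj : j ≤ r) {l : List NW}
    (hv : Valid 0 (l ++ [block r i j])) :
    join 0 (l ++ [block r i j]) < dia 2 (join 0 (l ++ [step r i])) := by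
  have hv' := valid_append_step hij hj hv
  obtain ⟨hs, hge, hx, -⟩ := hv'.of_append
  have h2 : Ge 2 (dia 2 (step r i)) := dia_ge (step_ge r i) le_rfl
  rw [dia_join (by omega) hv', join_lt_join hv (Valid.adjoin hs hge (h2.mono (by omega)))]
  exact append_lt_adjoin (block_lt hij hj h2 (lt_dia le_rfl (step_ge r i))) l []

/-- The condition involving `◇₂` forces the last block of `z` to be `step r i`; then `◇₃` turns it
into `top r i`, erasing all else. So `i` can be read off close enough below the word. -/
theorem dia_three_eq_top {r i j : ℕ} (hij : i ≤ j) (hj : j ≤ r) {l : List NW}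
    (hl : ∀ x ∈ l, IsBlock r x)
    (hv : Valid 0 (l ++ [block r i j])) {z : NW}
    (h1 : join 0 (l ++ [step r i]) ≤ z)
    (h2 : z < join 0 (l ++ [block r i j])) (h3 : join 0 (l ++ [block r i j]) < dia 2 z) :
    dia 3 z = top r i := by
  obtain ⟨m, hm, rfl⟩ := exists_join (ge_zero z)
  rw [join_le_join (valid_append_step hij hj hv) hm] at h1
  rw [join_lt_join hm hv] at h2
  obtain ⟨e, s, rfl, -, he⟩ := exists_of_mem_Ico h1 h2
  have hes := (List.pairwise_append.1 hm.sorted).2.1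
  have hall : ∀ x ∈ e :: s, x < block r i j := by
    intro x hx
    rcases List.mem_cons.1 hx with rfl | hx
    · exact he
    · exact ((List.pairwise_cons.1 hes).1 x hx).trans_lt he
  obtain ⟨u, x, hux⟩ : ∃ u x, e :: s = u ++ [x] :=
    ⟨_, _, (List.dropLast_append_getLast (List.cons_ne_nil e s)).symm⟩
  rw [hux] at hall hm h3 ⊢
  rw [← List.append_assoc] at hm h3 ⊢
  obtain ⟨hs, hge, hx, -⟩ := hm.of_append
  by_cases hxs : x = step r i
  · subst hxs
    rw [dia_join (by omega) hm, dia_step, adjoin_of_forall_lt, join_singleton]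
    intro a ha
    rcases List.mem_append.1 ha with ha | ha
    · exact (hl a ha).lt_top i
    · exact (hall a (by simp [ha])).trans (IsBlock.lt_top ⟨i, j, hij, hj, rfl⟩ i)
  -- Otherwise `◇₂` of the last block is still at most `block r i j`, so `◇₂ z` does not pass the
  -- given word.
  · exfalso
    have hc := dia_two_le_block hij hj hx (hall x (by simp)) hxs
    have hva : Valid 0 (adjoin (l ++ u) (dia 2 x)) := Valid.adjoin hs hge (dia_ge hx (by omega))
    rw [dia_join (by omega) hm, join_lt_join hv hva,
      adjoin_append fun a ha => hc.trans (hv.of_append.2.2.2 a ha), append_lt_append_iff] at h3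
    exact (adjoin_le_singleton (fun a ha => hall a (by simp [ha])) hc).not_gt h3


/-! ### Words with symbols at most `3` -/

/-- All symbols of the word are at most `3`. -/
def Low (x : NW) : Prop := ∀ s ∈ x.word, s ≤ 3

theorem low_nil : Low nil := fun s hs => by simp [nil] at hs

theorem low_dia {x : NW} (h : Low x) {i : ℕ} (hi : i ≤ 3) : Low (dia i x) := by
  intro s hs
  rcases List.mem_append.1 (normalForm_subset _ hs) with h1 | h1
  · exact h s h1
  · rw [List.mem_singleton.1 h1]
    exact hi

theorem low_join {n : ℕ} (hn : n ≤ 3) {l : List NW} (h : ∀ x ∈ l, Low x) : Low (join n l) := by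
  intro s hs
  rcases mem_intercalate (normalForm_subset _ hs) with ⟨rfl, -⟩ | ⟨A, hA, h1⟩
  · exact hn
  · obtain ⟨a, ha, rfl⟩ := List.mem_map.1 hA
    exact h a ha s h1

theorem low_three (m : ℕ) : Low (three m) := by
  induction m with
  | zero => exact low_nil
  | succ m ih => exact three_succ m ▸ low_dia ih le_rfl

theorem low_step (r j : ℕ) : Low (step r j) := by
  refine low_join (by omega) fun x hx => ?_
  rcases List.mem_append.1 hx with hx | hx
  · obtain ⟨i, -, rfl⟩ := List.mem_map.1 hx
    exact low_three _
  · rw [List.mem_singleton.1 hx]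
    exact low_three j

theorem IsBlock.low {r : ℕ} {x : NW} (h : IsBlock r x) : Low x := by
  obtain ⟨i, j, -, -, rfl⟩ := h
  refine low_join (by omega) fun x hx => ?_
  simp only [List.mem_cons, List.not_mem_nil, or_false] at hx
  rcases hx with rfl | rfl <;> exact low_step _ _

end NW

/-! ### Coding finite relations in `W_α^N` -/

namespace WN

variable {α : ℕ∞}

/-- An element of `W_α^N` as a word in normal form. -/
def toNW (x : WN α) : NW := ⟨x.1, x.2.1⟩

theorem toNW_injective : Function.Injective (toNW (α := α)) := fun _ _ h =>
  Subtype.ext (congrArg NW.word h)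

noncomputable instance : LinearOrder (WN α) := LinearOrder.lift' toNW toNW_injective

theorem toNW_le_toNW {x y : WN α} : x.toNW ≤ y.toNW ↔ x ≤ y := Iff.rfl

theorem toNW_lt_toNW {x y : WN α} : x.toNW < y.toNW ↔ x < y := Iff.rfl

/-- The operator `◇ᵢ` if `i ≤ α`, and the identity otherwise. -/
noncomputable def dia (i : ℕ) (x : WN α) : WN α :=
  if h : (i : ℕ∞) ≤ α then WN.diamond i h x else x

theorem toNW_dia {i : ℕ} (h : (i : ℕ∞) ≤ α) (x : WN α) : (dia i x).toNW = NW.dia i x.toNW := by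
  rw [dia, dif_pos h]
  rfl

theorem natCast_le (hα : 3 ≤ α) {i : ℕ} (hi : i ≤ 3) : (i : ℕ∞) ≤ α :=
  le_trans (by exact_mod_cast hi) hα

theorem exists_toNW_eq (hα : 3 ≤ α) {x : NW} (hx : x.Low) : ∃ y : WN α, y.toNW = x :=
  ⟨⟨x.word, x.isNF, fun s hs => natCast_le hα (hx s hs)⟩, rfl⟩

/-- The list of `y` is an initial segment of the list of `w`. -/
def IsInit (y w : WN α) : Prop := y ≤ w ∧ w < dia 1 y

/-- `x` is one of the finitely many elements listed by `w`. -/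
def Tag (w x : WN α) : Prop := ∃ y, IsInit y w ∧ dia 3 y = x

/-- `a` is one of the numbers over the base `D`. -/
def Num (D a : WN α) : Prop :=
  ∃ w, Tag w a ∧ ∀ x, Tag w x → x = dia 3 D ∨ ∃ y, Tag w y ∧ x = dia 3 y

/-- The final block of `y` codes a pair with the first component `a`. -/
def Fst (y a : WN α) : Prop :=
  ∃ z, z < y ∧ y < dia 2 z ∧ ∀ u, z ≤ u → u < y → y < dia 2 u → dia 3 u = a

/-- The pair `(a, b)` is one of the finitely many pairs listed by `w`. -/
def Edge (w a b : WN α) : Prop := ∃ y, IsInit y w ∧ dia 3 y = b ∧ Fst y a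

/-- The finite relation coded by `w` and `w'`. -/
def Rel (w w' a b : WN α) : Prop := (a ≤ b ∧ Edge w a b) ∨ (b ≤ a ∧ Edge w' b a)

/-- The number `n` over the base `D`. -/
noncomputable def num (D : WN α) (n : ℕ) : WN α := (dia 3)^[n + 1] D

theorem dia_num (D : WN α) (n : ℕ) : dia 3 (num D n) = num D (n + 1) :=
  (Function.iterate_succ_apply' (dia 3) (n + 1) D).symm

theorem lt_dia_three (hα : 3 ≤ α) (x : WN α) : x < dia 3 x := by
  rw [← toNW_lt_toNW, toNW_dia (natCast_le hα le_rfl)]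
  exact NW.lt_dia (Nat.zero_le 3) (NW.ge_zero _)

theorem num_strictMono (hα : 3 ≤ α) (D : WN α) : StrictMono (num D) :=
  strictMono_nat_of_lt_succ fun n => dia_num D n ▸ lt_dia_three hα _

theorem isInit_iff (hα : 3 ≤ α) {y w : WN α} :
    IsInit y w ↔ y.toNW ≤ w.toNW ∧ w.toNW < NW.dia 1 y.toNW := by
  rw [← toNW_dia (natCast_le hα (by omega)), toNW_le_toNW, toNW_lt_toNW, IsInit]

theorem finite_tag (hα : 3 ≤ α) (w : WN α) : {x | Tag w x}.Finite := by
  have h1 : {y : WN α | IsInit y w}.Finite := by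
    refine ((NW.finite_initial w.toNW).preimage (toNW_injective.injOn)).subset ?_
    intro y hy
    exact (isInit_iff hα).1 hy
  refine (h1.image (dia 3)).subset ?_
  rintro x ⟨y, hy, rfl⟩
  exact ⟨y, hy, rfl⟩

/-- Every number is standard, and the numbers are closed downwards. -/
theorem Num.exists_eq (hα : 3 ≤ α) {D a : WN α} (h : Num D a) :
    ∃ n, a = num D n ∧ ∀ k ≤ n, Num D (num D k) := by
  obtain ⟨w, ha, hw⟩ := h
  suffices ∀ x, Tag w x → ∃ n, x = num D n ∧ ∀ k ≤ n, Tag w (num D k) by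
    obtain ⟨n, hn, hk⟩ := this a ha
    exact ⟨n, hn, fun k hkn => ⟨w, hk k hkn, hw⟩⟩
  by_contra! hbad
  let S := {x | Tag w x ∧ ∀ n, x = num D n → ∃ k ≤ n, ¬ Tag w (num D k)}
  have hS : S.Finite := (finite_tag hα w).subset fun x hx => hx.1
  have hne : S.Nonempty := hbad
  -- A least bad label exists by finiteness; its predecessor under `◇₃` is smaller, hence good,
  -- which makes the label itself good.
  obtain ⟨x, hx, hmin⟩ := Set.exists_min_image S id hS hne
  rcases hw x hx.1 with h | ⟨y, hy, h⟩
  · obtain ⟨k, hk, hkt⟩ := hx.2 0 h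
    obtain rfl : k = 0 := by omega
    have h' : x = num D 0 := h
    exact hkt (h' ▸ hx.1)
  · have hyx : y < x := h ▸ lt_dia_three hα y
    have hyS : y ∉ S := fun hyS => (hmin y hyS).not_gt hyx
    have : ∃ n, y = num D n ∧ ∀ k ≤ n, Tag w (num D k) := by
      by_contra! hc
      exact hyS ⟨hy, hc⟩
    obtain ⟨n, rfl, hn⟩ := this
    rw [dia_num] at h
    obtain ⟨k, hk, hkt⟩ := hx.2 (n + 1) h
    rcases Nat.lt_or_ge n k with hnk | hnk
    · obtain rfl : k = n + 1 := by omega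
      exact hkt (h ▸ hx.1)
    · exact hkt (hn k hnk)

/-- The list of `y` consists of blocks, the last of them being the block of `(i, j)`. -/
def EndsIn (r i j : ℕ) (y : WN α) : Prop :=
  ∃ l : List NW, (∀ x ∈ l, NW.IsBlock r x) ∧ NW.Valid 0 (l ++ [NW.block r i j]) ∧
    y.toNW = NW.join 0 (l ++ [NW.block r i j])

theorem toNW_num (hα : 3 ≤ α) {r : ℕ} {D : WN α} (hD : D.toNW = NW.step r 0) (n : ℕ) :
    (num D n).toNW = NW.top r n := by
  have h3 : ((3 : ℕ) : ℕ∞) ≤ α := natCast_le hα le_rfl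
  induction n with
  | zero => exact (toNW_dia h3 D).trans (by rw [hD, NW.dia_step])
  | succ n ih => rw [← dia_num, toNW_dia h3, ih, NW.dia_top]

theorem EndsIn.dia_three (hα : 3 ≤ α) {r i j : ℕ} (hij : i ≤ j) (hj : j ≤ r) {D y : WN α}
    (hD : D.toNW = NW.step r 0) (h : EndsIn r i j y) : dia 3 y = num D j := by
  obtain ⟨l, hl, hv, hy⟩ := h
  apply toNW_injective
  rw [toNW_dia (natCast_le hα le_rfl), toNW_num hα hD, hy, NW.dia_three_join_block hij hj hl hv]

theorem EndsIn.fst_iff (hα : 3 ≤ α) {r i j : ℕ} (hij : i ≤ j) (hj : j ≤ r) {D y : WN α}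
    (hD : D.toNW = NW.step r 0) (h : EndsIn r i j y) {a : WN α} : Fst y a ↔ a = num D i := by
  have h2 : ((2 : ℕ) : ℕ∞) ≤ α := natCast_le hα (by omega)
  have h3 : ((3 : ℕ) : ℕ∞) ≤ α := natCast_le hα le_rfl
  obtain ⟨l, hl, hv, hy⟩ := h
  obtain ⟨z₀, hz₀⟩ := exists_toNW_eq hα (x := NW.join 0 (l ++ [NW.step r i])) (by
    refine NW.low_join (by omega) fun x hx => ?_
    rcases List.mem_append.1 hx with hx | hx
    · exact (hl x hx).low
    · rw [List.mem_singleton.1 hx]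
      exact NW.low_step r i)
  have key : z₀ < y ∧ y < dia 2 z₀ ∧
      ∀ u, z₀ ≤ u → u < y → y < dia 2 u → dia 3 u = num D i := by
    refine ⟨?_, ?_, fun u hu1 hu2 hu3 => ?_⟩
    · rw [← toNW_lt_toNW, hz₀, hy]
      exact NW.join_step_lt hij hj hv
    · rw [← toNW_lt_toNW, toNW_dia h2, hz₀, hy]
      exact NW.lt_dia_two_join_step hij hj hv
    · rw [← toNW_le_toNW, hz₀] at hu1
      rw [← toNW_lt_toNW, hy] at hu2
      rw [← toNW_lt_toNW, toNW_dia h2, hy] at hu3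
      apply toNW_injective
      rw [toNW_dia h3, toNW_num hα hD]
      exact NW.dia_three_eq_top hij hj hl hv hu1 hu2 hu3
  constructor
  · rintro ⟨z, hz1, hz2, hz3⟩
    -- The larger of the two witnesses satisfies the conditions of both, so both prescribe the same
    -- value of `◇₃`.
    rcases le_total z z₀ with hz | hz
    · rw [← hz3 z₀ hz key.1 key.2.1, key.2.2 z₀ le_rfl key.1 key.2.1]
    · rw [← hz3 z le_rfl hz1 hz2, key.2.2 z hz hz1 hz2]
  · rintro rfl
    exact ⟨z₀, key⟩

/-- The code lists all blocks of pairs in `R` in decreasing order; each block ends exactly one of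
its nonempty initial segments. -/
theorem exists_code (hα : 3 ≤ α) {r : ℕ} {R : Finset (ℕ × ℕ)} (hR : R.Nonempty)
    (h : ∀ p ∈ R, p.1 ≤ p.2 ∧ p.2 ≤ r) : ∃ w : WN α,
      (∀ y, IsInit y w → ∃ p ∈ R, EndsIn r p.1 p.2 y) ∧
        ∀ p ∈ R, ∃ y, IsInit y w ∧ EndsIn r p.1 p.2 y := by
  classical
  set L := (R.image fun p => NW.block r p.1 p.2).sort (· ≥ ·) with hL
  have hmem : ∀ x, x ∈ L ↔ ∃ p ∈ R, NW.block r p.1 p.2 = x := by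
    intro x
    rw [hL, Finset.mem_sort, Finset.mem_image]
  have hblock : ∀ x ∈ L, NW.IsBlock r x := by
    intro x hx
    obtain ⟨p, hp, rfl⟩ := (hmem x).1 hx
    exact ⟨p.1, p.2, (h p hp).1, (h p hp).2, rfl⟩
  have hv : NW.Valid 0 L := by
    refine ⟨?_, Finset.pairwise_sort _ _, fun x hx => ?_⟩
    · obtain ⟨p, hp⟩ := hR
      exact List.ne_nil_of_mem ((hmem _).2 ⟨p, hp, rfl⟩)
    · obtain ⟨p, hp, rfl⟩ := (hmem x).1 hx
      exact NW.block_ge (h p hp).1 (h p hp).2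
  obtain ⟨w, hw⟩ := exists_toNW_eq hα (NW.low_join (Nat.zero_le 3) fun x hx => (hblock x hx).low)
  refine ⟨w, fun y hy => ?_, fun p hp => ?_⟩
  · rw [isInit_iff hα, hw] at hy
    obtain ⟨l, hl, hne, hyl⟩ := NW.exists_prefix_of_lt_dia_one hv hy.1 hy.2
    have hvl := hv.of_prefix hl hne
    obtain ⟨m, x, rfl⟩ := hvl.exists_append
    obtain ⟨p, hp, rfl⟩ := (hmem x).1 (hl.subset (by simp))
    exact ⟨p, hp, m, fun x hx => hblock x (hl.subset (by simp [hx])), hvl, hyl⟩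
  · obtain ⟨m, t, hmt⟩ := List.append_of_mem ((hmem _).2 ⟨p, hp, rfl⟩)
    rw [hmt] at hv hblock hw
    have hvl := hv.of_prefix (l := m ++ [NW.block r p.1 p.2]) ⟨t, by simp⟩ (by simp)
    obtain ⟨y, hy⟩ := exists_toNW_eq hα (x := NW.join 0 (m ++ [NW.block r p.1 p.2]))
      (NW.low_join (by omega) fun x hx => by
        rcases List.mem_append.1 hx with hx | hx
        · exact (hblock x (by simp [hx])).low
        · exact (hblock x (by rw [List.mem_singleton.1 hx]; simp)).low)
    refine ⟨y, ?_, m, fun x hx => hblock x (by simp [hx]), hvl, hy⟩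
    rw [isInit_iff hα, hy, hw]
    exact NW.lt_dia_one_of_prefix hv

theorem exists_edge (hα : 3 ≤ α) {r : ℕ} {D : WN α} (hD : D.toNW = NW.step r 0)
    {R : Finset (ℕ × ℕ)} (h : ∀ p ∈ R, p.1 ≤ p.2 ∧ p.2 ≤ r) :
    ∃ w : WN α, ∀ i j, Edge w (num D i) (num D j) ↔ (i, j) ∈ R := by
  rcases R.eq_empty_or_nonempty with rfl | hR
  -- `Λ` codes the empty relation: `Fst` needs an element strictly below `y ≤ Λ`.
  · obtain ⟨w, hw⟩ := exists_toNW_eq hα NW.low_nil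
    refine ⟨w, fun i j => ⟨?_, by simp⟩⟩
    rintro ⟨y, hy, -, z, hz, -⟩
    exact absurd (hz.trans_le hy.1) (by
      rw [← toNW_lt_toNW, hw, not_lt]
      exact NW.nil_le _)
  · obtain ⟨w, hw1, hw2⟩ := exists_code hα hR h
    refine ⟨w, fun i j => ⟨?_, fun hp => ?_⟩⟩
    · rintro ⟨y, hy, hyb, hya⟩
      obtain ⟨p, hp, hend⟩ := hw1 y hy
      obtain ⟨h1, h2⟩ := h p hp
      rw [hend.dia_three hα h1 h2 hD] at hyb
      rw [hend.fst_iff hα h1 h2 hD] at hya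
      have e1 := (num_strictMono hα D).injective hyb
      have e2 := (num_strictMono hα D).injective hya
      rw [e2, ← e1]
      exact hp
    · obtain ⟨y, hy, hend⟩ := hw2 _ hp
      obtain ⟨h1, h2⟩ := h _ hp
      exact ⟨y, hy, hend.dia_three hα h1 h2 hD, (hend.fst_iff hα h1 h2 hD).2 rfl⟩

/-- There are bases with arbitrarily many numbers and codes for all relations on them. -/
theorem exists_base (hα : 3 ≤ α) (r : ℕ) : ∃ D : WN α, (∀ n ≤ r, Num D (num D n)) ∧
    ∀ R : Finset (ℕ × ℕ), (∀ p ∈ R, p.1 ≤ r ∧ p.2 ≤ r) →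
      ∃ w w', ∀ i j, Rel w w' (num D i) (num D j) ↔ (i, j) ∈ R := by
  classical
  obtain ⟨D, hD⟩ := exists_toNW_eq hα (NW.low_step r 0)
  refine ⟨D, fun n hn => ?_, fun R hR => ?_⟩
  -- The diagonal pairs provide a word whose labels are exactly the numbers up to `n`.
  · have hR : ∀ p ∈ (Finset.range (n + 1)).image fun i => (i, i), p.1 ≤ p.2 ∧ p.2 ≤ r := by
      intro p hp
      obtain ⟨i, hi, rfl⟩ := Finset.mem_image.1 hp
      have := Finset.mem_range.1 hi
      exact ⟨le_rfl, by dsimp only; omega⟩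
    obtain ⟨w, hw1, hw2⟩ := exists_code hα (by simp) hR
    have htag : ∀ k ≤ n, Tag w (num D k) := by
      intro k hk
      have hp : (k, k) ∈ (Finset.range (n + 1)).image fun i => (i, i) := by
        simpa using Nat.lt_succ_of_le hk
      obtain ⟨y, hy, hend⟩ := hw2 _ hp
      exact ⟨y, hy, hend.dia_three hα le_rfl (by omega) hD⟩
    refine ⟨w, htag n le_rfl, ?_⟩
    rintro x ⟨y, hy, rfl⟩
    obtain ⟨p, hp, hend⟩ := hw1 y hy
    rw [hend.dia_three hα (hR p hp).1 (hR p hp).2 hD]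
    obtain ⟨k, hk, rfl⟩ := Finset.mem_image.1 hp
    cases k with
    | zero => exact Or.inl rfl
    | succ k =>
      have := Finset.mem_range.1 hk
      exact Or.inr ⟨num D k, htag k (by omega), (dia_num D k).symm⟩
  · obtain ⟨w, hw⟩ := exists_edge hα hD (R := R.filter fun p => p.1 ≤ p.2) fun p hp =>
      ⟨(Finset.mem_filter.1 hp).2, (hR p (Finset.mem_filter.1 hp).1).2⟩
    -- Blocks only code increasing pairs, so the pairs in the other direction are stored reversed in
    -- a second word.
    obtain ⟨w', hw'⟩ := exists_edge hα hD (R := (R.image Prod.swap).filter fun p => p.1 ≤ p.2) (by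
      intro p hp
      obtain ⟨hp1, hp2⟩ := Finset.mem_filter.1 hp
      obtain ⟨q, hq, rfl⟩ := Finset.mem_image.1 hp1
      exact ⟨hp2, (hR q hq).1⟩)
    refine ⟨w, w', fun i j => ?_⟩
    have hm : ∀ a b, num D a ≤ num D b ↔ a ≤ b := fun _ _ => (num_strictMono hα D).le_iff_le
    rw [Rel, hw, hw', hm, hm]
    have hs : (j, i) ∈ R.image Prod.swap ↔ (i, j) ∈ R := by simp
    rw [Finset.mem_filter, Finset.mem_filter, hs]
    have := le_total i j
    tauto


/-! ### First-order definability -/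

/-- The relation `P` is defined by a first-order formula. -/
def Def (P : (ℕ → WN α) → Prop) : Prop :=
  ∃ φ : (notationLanguage α).Formula ℕ, ∀ v, φ.Realize v ↔ P v

/-- The operation `t` is given by a term. -/
def DefTerm (t : (ℕ → WN α) → WN α) : Prop :=
  ∃ τ : (notationLanguage α).Term ℕ, ∀ v, τ.realize v = t v

theorem DefTerm.var (i : ℕ) : DefTerm (α := α) (fun v => v i) :=
  ⟨FirstOrder.Language.var i, fun _ => rfl⟩

/-- The identity as default value for `i > α` is also given by a term, so definability needs no
bound on `i`. -/
theorem DefTerm.dia (i : ℕ) {t : (ℕ → WN α) → WN α} (ht : DefTerm t) :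
    DefTerm (fun v => dia i (t v)) := by
  obtain ⟨τ, hτ⟩ := ht
  by_cases h : (i : ℕ∞) ≤ α
  · refine ⟨.func (NotationFunc.diamond i h : (notationLanguage α).Functions 1) fun _ => τ,
      fun v => ?_⟩
    change _ = WN.dia i (t v)
    rw [WN.dia, dif_pos h, ← hτ]
    rfl
  · refine ⟨τ, fun v => ?_⟩
    change _ = WN.dia i (t v)
    rw [WN.dia, dif_neg h, hτ]

theorem Def.congr {P Q : (ℕ → WN α) → Prop} (h : Def P) (hPQ : ∀ v, P v ↔ Q v) : Def Q :=
  h.imp fun _ hφ v => (hφ v).trans (hPQ v)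

theorem Def.lt {s t : (ℕ → WN α) → WN α} (hs : DefTerm s) (ht : DefTerm t) :
    Def (fun v => s v < t v) := by
  obtain ⟨σ, hσ⟩ := hs
  obtain ⟨τ, hτ⟩ := ht
  refine ⟨FirstOrder.Language.Relations.formula₂ (L := notationLanguage α) NotationRel.prec σ τ,
    fun v => ?_⟩
  refine FirstOrder.Language.Formula.realize_rel₂.trans ?_
  rw [hσ, hτ]
  rfl

theorem Def.eq {s t : (ℕ → WN α) → WN α} (hs : DefTerm s) (ht : DefTerm t) :
    Def (fun v => s v = t v) := by
  obtain ⟨σ, hσ⟩ := hs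
  obtain ⟨τ, hτ⟩ := ht
  exact ⟨σ.equal τ, fun v => by rw [FirstOrder.Language.Formula.realize_equal, hσ, hτ]⟩

theorem Def.not {P : (ℕ → WN α) → Prop} (h : Def P) : Def (fun v => ¬ P v) := by
  obtain ⟨φ, hφ⟩ := h
  exact ⟨φ.not, fun v => by rw [FirstOrder.Language.Formula.realize_not, hφ]⟩

theorem Def.imp {P Q : (ℕ → WN α) → Prop} (h : Def P) (h' : Def Q) :
    Def (fun v => P v → Q v) := by
  obtain ⟨φ, hφ⟩ := h
  obtain ⟨ψ, hψ⟩ := h'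
  exact ⟨φ.imp ψ, fun v => by rw [FirstOrder.Language.Formula.realize_imp, hφ, hψ]⟩

theorem Def.or {P Q : (ℕ → WN α) → Prop} (h : Def P) (h' : Def Q) : Def (fun v => P v ∨ Q v) :=
  (h.not.imp h').congr fun _ => by tauto

theorem Def.and {P Q : (ℕ → WN α) → Prop} (h : Def P) (h' : Def Q) : Def (fun v => P v ∧ Q v) :=
  (h.imp h'.not).not.congr fun _ => by tauto

theorem Def.le {s t : (ℕ → WN α) → WN α} (hs : DefTerm s) (ht : DefTerm t) :
    Def (fun v => s v ≤ t v) :=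
  (Def.lt ht hs).not.congr fun _ => not_lt

theorem Def.subst {P : (ℕ → WN α) → Prop} (h : Def P) {t : ℕ → (ℕ → WN α) → WN α}
    (ht : ∀ i, DefTerm (t i)) : Def (fun v => P fun i => t i v) := by
  obtain ⟨φ, hφ⟩ := h
  choose τ hτ using ht
  refine ⟨φ.subst τ, fun v => ?_⟩
  rw [FirstOrder.Language.Formula.Realize, FirstOrder.Language.BoundedFormula.realize_subst]
  simp only [hτ]
  exact hφ _

theorem Def.comp {P : (ℕ → WN α) → Prop} (h : Def P) (f : ℕ → ℕ) :
    Def (fun v => P fun i => v (f i)) := h.subst fun i => .var (f i)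

theorem Def.all {Q : (ℕ → WN α) → WN α → Prop} (h : Def fun v => Q (fun i => v (i + 1)) (v 0)) :
    Def (fun v => ∀ x, Q v x) := by
  obtain ⟨φ, hφ⟩ := h
  -- Variable `0` becomes the bound one, and the others are shifted down.
  let g : ℕ → ℕ ⊕ Fin 1 := fun n => Nat.casesOn n (Sum.inr 0) Sum.inl
  let ψ : (notationLanguage α).BoundedFormula ℕ 1 :=
    FirstOrder.Language.BoundedFormula.relabel (k := 0) g φ
  refine ⟨ψ.all, fun v => ?_⟩
  refine forall_congr' fun x => ?_
  refine (FirstOrder.Language.BoundedFormula.realize_relabel (n := 0)).trans ?_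
  have key : ∀ (w : ℕ → WN α) (xs : Fin 0 → WN α),
      FirstOrder.Language.BoundedFormula.Realize φ w xs ↔ Q (fun i => w (i + 1)) (w 0) :=
    fun w xs => by
      rw [Subsingleton.elim xs default]
      exact hφ w
  exact key _ _

theorem Def.ex {Q : (ℕ → WN α) → WN α → Prop} (h : Def fun v => Q (fun i => v (i + 1)) (v 0)) :
    Def (fun v => ∃ x, Q v x) :=
  (Def.all (Q := fun v x => ¬ Q v x) h.not).not.congr fun v => by simp

theorem Def.app₂ {P : WN α → WN α → Prop} (h : Def fun v => P (v 0) (v 1))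
    {s t : (ℕ → WN α) → WN α} (hs : DefTerm s) (ht : DefTerm t) :
    Def (fun v => P (s v) (t v)) :=
  h.subst (t := fun | 0 => s | _ => t) fun | 0 => hs | _ + 1 => ht

theorem Def.app₃ {P : WN α → WN α → WN α → Prop} (h : Def fun v => P (v 0) (v 1) (v 2))
    {s t u : (ℕ → WN α) → WN α} (hs : DefTerm s) (ht : DefTerm t) (hu : DefTerm u) :
    Def (fun v => P (s v) (t v) (u v)) :=
  h.subst (t := fun | 0 => s | 1 => t | _ => u) fun | 0 => hs | 1 => ht | _ + 2 => hu

theorem Def.app₄ {P : WN α → WN α → WN α → WN α → Prop}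
    (h : Def fun v => P (v 0) (v 1) (v 2) (v 3)) {s t u w : (ℕ → WN α) → WN α}
    (hs : DefTerm s) (ht : DefTerm t) (hu : DefTerm u) (hw : DefTerm w) :
    Def (fun v => P (s v) (t v) (u v) (w v)) :=
  h.subst (t := fun | 0 => s | 1 => t | 2 => u | _ => w)
    fun | 0 => hs | 1 => ht | 2 => hu | _ + 3 => hw

theorem def_isInit : Def (α := α) fun v => IsInit (v 0) (v 1) :=
  .and (.le (.var 0) (.var 1)) (.lt (.var 1) (.dia 1 (.var 0)))

theorem def_tag : Def (α := α) fun v => Tag (v 0) (v 1) :=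
  .ex (.and (def_isInit.app₂ (.var 0) (.var 1)) (.eq (.dia 3 (.var 0)) (.var 2)))

theorem def_num : Def (α := α) fun v => Num (v 0) (v 1) :=
  .ex (.and (def_tag.app₂ (.var 0) (.var 2)) (.all (.imp (def_tag.app₂ (.var 1) (.var 0))
    (.or (.eq (.var 0) (.dia 3 (.var 2)))
      (.ex (.and (def_tag.app₂ (.var 2) (.var 0)) (.eq (.var 1) (.dia 3 (.var 0)))))))))

theorem def_fst : Def (α := α) fun v => Fst (v 0) (v 1) :=
  .ex (.and (.lt (.var 0) (.var 1)) (.and (.lt (.var 1) (.dia 2 (.var 0)))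
    (.all (.imp (.le (.var 1) (.var 0)) (.imp (.lt (.var 0) (.var 2))
      (.imp (.lt (.var 2) (.dia 2 (.var 0))) (.eq (.dia 3 (.var 0)) (.var 3))))))))

theorem def_edge : Def (α := α) fun v => Edge (v 0) (v 1) (v 2) :=
  .ex (.and (def_isInit.app₂ (.var 0) (.var 1)) (.and (.eq (.dia 3 (.var 0)) (.var 3))
    (def_fst.app₂ (.var 0) (.var 2))))

theorem def_rel : Def (α := α) fun v => Rel (v 0) (v 1) (v 2) (v 3) :=
  .or (.and (.le (.var 2) (.var 3)) (def_edge.app₃ (.var 0) (.var 2) (.var 3)))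
    (.and (.le (.var 3) (.var 2)) (def_edge.app₃ (.var 1) (.var 3) (.var 2)))

/-! ### Arithmetic over a base -/

/-- There are at least `r + 1` numbers over the base `D`, and all relations between them are
coded. -/
def IsBase (r : ℕ) (D : WN α) : Prop :=
  (∀ n ≤ r, Num D (num D n)) ∧ ∀ R : Finset (ℕ × ℕ), (∀ p ∈ R, p.1 ≤ r ∧ p.2 ≤ r) →
    ∃ w w', ∀ i j, Rel w w' (num D i) (num D j) ↔ (i, j) ∈ R

/-- The list `x, v 0, v 1, …`. -/
def cons {X : Type*} (x : X) (v : ℕ → X) : ℕ → X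
  | 0 => x
  | n + 1 => v n

theorem comp_cons {X Y : Type*} (f : X → Y) (x : X) (v : ℕ → X) :
    (fun i => f (cons x v i)) = cons (f x) fun i => f (v i) :=
  funext fun | 0 => rfl | _ + 1 => rfl

variable (α) in
/-- The relation `R` on natural numbers is defined uniformly over all sufficiently large bases by
a relation that is sound over arbitrary bases. -/
def Good (R : (ℕ → ℕ) → Prop) : Prop :=
  ∃ P : WN α → (ℕ → WN α) → Prop, Def (fun v => P (v 0) fun i => v (i + 1)) ∧
    (∀ D e, P D (fun i => num D (e i)) → R e) ∧
    ∀ e, R e → ∃ r₀, ∀ r ≥ r₀, ∀ D, IsBase r D → P D fun i => num D (e i)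

theorem Good.congr {R S : (ℕ → ℕ) → Prop} (h : Good α R) (hRS : ∀ e, R e ↔ S e) : Good α S := by
  obtain ⟨P, hP, h1, h2⟩ := h
  exact ⟨P, hP, fun D e h => (hRS e).1 (h1 D e h), fun e h => h2 e ((hRS e).2 h)⟩

theorem Good.comp {R : (ℕ → ℕ) → Prop} (h : Good α R) (f : ℕ → ℕ) :
    Good α (fun e => R fun i => e (f i)) := by
  obtain ⟨P, hP, h1, h2⟩ := h
  refine ⟨fun D v => P D fun i => v (f i), ?_, fun D e => h1 D fun i => e (f i),
    fun e => h2 fun i => e (f i)⟩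
  -- Index `0` holds the base, so the renaming is shifted past it.
  exact hP.comp fun | 0 => 0 | i + 1 => f i + 1

theorem Good.eq (hα : 3 ≤ α) (i j : ℕ) : Good α (fun e => e i = e j) :=
  ⟨fun _ v => v i = v j, .eq (.var _) (.var _), fun D _ h => (num_strictMono hα D).injective h,
    fun _ h => ⟨0, fun _ _ D _ => congrArg (num D) h⟩⟩

theorem Good.lt (hα : 3 ≤ α) (i j : ℕ) : Good α (fun e => e i < e j) :=
  ⟨fun _ v => v i < v j, .lt (.var _) (.var _), fun D _ h => (num_strictMono hα D).lt_iff_lt.1 h,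
    fun _ h => ⟨0, fun _ _ D _ => num_strictMono hα D h⟩⟩

theorem Good.eq_zero (hα : 3 ≤ α) (i : ℕ) : Good α (fun e => e i = 0) :=
  ⟨fun D v => v i = dia 3 D, .eq (.var _) (.dia 3 (.var 0)),
    fun D _ h => (num_strictMono hα D).injective (a₂ := 0) h,
    fun _ h => ⟨0, fun _ _ D _ => congrArg (num D) h⟩⟩

theorem Good.eq_succ (hα : 3 ≤ α) (i j : ℕ) : Good α (fun e => e i = e j + 1) :=
  ⟨fun _ v => v i = dia 3 (v j), .eq (.var _) (.dia 3 (.var _)),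
    fun D e h => (num_strictMono hα D).injective (h.trans (dia_num D (e j))),
    fun e h => ⟨0, fun _ _ D _ => (congrArg (num D) h).trans (dia_num D (e j)).symm⟩⟩

theorem Good.and {R S : (ℕ → ℕ) → Prop} (h : Good α R) (h' : Good α S) :
    Good α (fun e => R e ∧ S e) := by
  obtain ⟨P, hP, h1, h2⟩ := h
  obtain ⟨Q, hQ, h3, h4⟩ := h'
  refine ⟨fun D v => P D v ∧ Q D v, hP.and hQ, fun D e h => ⟨h1 D e h.1, h3 D e h.2⟩, ?_⟩
  rintro e ⟨hR, hS⟩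
  obtain ⟨r₁, hr₁⟩ := h2 e hR
  obtain ⟨r₂, hr₂⟩ := h4 e hS
  exact ⟨max r₁ r₂, fun r hr D hD =>
    ⟨hr₁ r (le_trans (le_max_left _ _) hr) D hD, hr₂ r (le_trans (le_max_right _ _) hr) D hD⟩⟩

theorem Good.or {R S : (ℕ → ℕ) → Prop} (h : Good α R) (h' : Good α S) :
    Good α (fun e => R e ∨ S e) := by
  obtain ⟨P, hP, h1, h2⟩ := h
  obtain ⟨Q, hQ, h3, h4⟩ := h'
  refine ⟨fun D v => P D v ∨ Q D v, hP.or hQ, fun D e h => h.imp (h1 D e) (h3 D e), ?_⟩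
  rintro e (hR | hS)
  · obtain ⟨r₁, hr₁⟩ := h2 e hR
    exact ⟨r₁, fun r hr D hD => Or.inl (hr₁ r hr D hD)⟩
  · obtain ⟨r₂, hr₂⟩ := h4 e hS
    exact ⟨r₂, fun r hr D hD => Or.inr (hr₂ r hr D hD)⟩

theorem Def.cons {P : WN α → (ℕ → WN α) → Prop} (hP : Def fun v => P (v 0) fun i => v (i + 1)) :
    Def (fun v => P (v 1) (cons (v 0) fun i => v (i + 2))) := by
  refine (hP.comp fun | 0 => 1 | 1 => 0 | i + 2 => i + 2).congr fun v => ?_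
  refine iff_of_eq (congrArg (P (v 1)) (funext ?_))
  rintro (_ | i) <;> rfl

/-- The quantifier is restricted to `Num`. Soundness holds since all numbers are standard; for
completeness the base must be large enough to contain the witness. -/
theorem Good.ex (hα : 3 ≤ α) {R : (ℕ → ℕ) → ℕ → Prop}
    (h : Good α fun e => R (fun i => e (i + 1)) (e 0)) : Good α (fun e => ∃ x, R e x) := by
  obtain ⟨P, hP, h1, h2⟩ := h
  refine ⟨fun D v => ∃ y, Num D y ∧ P D (WN.cons y v),
    .ex (.and (def_num.app₂ (.var 1) (.var 0)) hP.cons), ?_, ?_⟩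
  · rintro D e ⟨y, hy, h⟩
    obtain ⟨n, rfl, -⟩ := hy.exists_eq hα
    rw [← comp_cons] at h
    exact ⟨n, h1 D _ h⟩
  · rintro e ⟨x, hx⟩
    obtain ⟨r₀, hr⟩ := h2 (WN.cons x e) hx
    refine ⟨max r₀ x, fun r hrr D hD =>
      ⟨num D x, hD.1 x (le_trans (le_max_right _ _) hrr), ?_⟩⟩
    rw [← comp_cons]
    exact hr r (le_trans (le_max_left _ _) hrr) D hD

theorem exists_bound {p : ℕ → ℕ → Prop} {n : ℕ} (h : ∀ k < n, ∃ r₀, ∀ r ≥ r₀, p k r) :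
    ∃ r₀, ∀ r ≥ r₀, ∀ k < n, p k r := by
  have : ∀ᶠ r in Filter.atTop, ∀ k ∈ Set.Iio n, p k r :=
    (Filter.eventually_all_finite (Set.finite_Iio n)).2 fun k hk =>
      Filter.eventually_atTop.2 (h k hk)
  exact Filter.eventually_atTop.1 this

/-- Over a short base a quantifier restricted to `Num` could miss numbers below the bound. Demanding
that the bound itself satisfy `Num` repairs this, as the numbers are closed downwards. -/
theorem Good.ball (hα : 3 ≤ α) {R : (ℕ → ℕ) → ℕ → Prop}
    (h : Good α fun e => R (fun i => e (i + 1)) (e 0)) (j : ℕ) :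
    Good α (fun e => ∀ x < e j, R e x) := by
  obtain ⟨P, hP, h1, h2⟩ := h
  refine ⟨fun D v => Num D (v j) ∧ ∀ y, Num D y → y < v j → P D (WN.cons y v),
    .and (def_num.app₂ (.var 0) (.var (j + 1))) (.all (.imp (def_num.app₂ (.var 1) (.var 0))
      (.imp (.lt (.var 0) (.var (j + 2))) hP.cons))), ?_, ?_⟩
  · rintro D e ⟨hn, h⟩ x hx
    obtain ⟨n, hn, hk⟩ := hn.exists_eq hα
    have hn := (num_strictMono hα D).injective hn
    have := h (num D x) (hk x (by omega)) (num_strictMono hα D hx)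
    rw [← comp_cons] at this
    exact h1 D _ this
  · intro e he
    obtain ⟨r₀, hr₀⟩ := exists_bound fun x hx => h2 (WN.cons x e) (he x hx)
    refine ⟨max r₀ (e j), fun r hr D hD => ⟨hD.1 _ (le_trans (le_max_right _ _) hr), ?_⟩⟩
    intro y hy hyj
    obtain ⟨x, rfl, -⟩ := hy.exists_eq hα
    have := hr₀ r (le_trans (le_max_left _ _) hr) x ((num_strictMono hα D).lt_iff_lt.1 hyj) D hD
    rw [← comp_cons]
    exact this

/-- Uniform definability is preserved by the iteration of relations. -/
theorem Good.iter (hα : 3 ≤ α) {R : (ℕ → ℕ) → ℕ → ℕ → ℕ → Prop}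
    (h : Good α fun e => R (fun i => e (i + 3)) (e 0) (e 1) (e 2)) (a b n : ℕ) :
    Good α (fun e => ∃ s : ℕ → ℕ, s 0 = e a ∧ s (e n) = e b ∧
      ∀ k < e n, R e k (s k) (s (k + 1))) := by
  classical
  obtain ⟨P, hP, h1, h2⟩ := h
  -- The relation codes the graph of `s`, with `dia 3 D` as the number `0`. For soundness it may be
  -- any relation, so every value at `k` is required to have a successor value at `k + 1`, and every
  -- value at `n` to be the prescribed one.
  refine ⟨fun D v => ∃ w w', Num D (v n) ∧ Num D (v a) ∧ Rel w w' (dia 3 D) (v a) ∧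
    (∀ u, Num D u → Rel w w' (v n) u → u = v b) ∧
    ∀ k, Num D k → k < v n → ∀ u, Num D u → Rel w w' k u →
      ∃ u', Num D u' ∧ Rel w w' (dia 3 k) u' ∧ P D (WN.cons k (WN.cons u (WN.cons u' v))),
    ?_, ?_, ?_⟩
  · have hP' : Def fun v : ℕ → WN α => P (v 5) (WN.cons (v 2) (WN.cons (v 1)
        (WN.cons (v 0) fun i => v (i + 6)))) := by
      refine (hP.comp fun | 0 => 5 | 1 => 2 | 2 => 1 | 3 => 0 | i + 4 => i + 6).congr fun v => ?_
      refine iff_of_eq (congrArg (P (v 5)) (funext ?_))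
      rintro (_ | _ | _ | i) <;> rfl
    exact .ex (.ex (.and (def_num.app₂ (.var 2) (.var (n + 3)))
      (.and (def_num.app₂ (.var 2) (.var (a + 3)))
      (.and (def_rel.app₄ (.var 1) (.var 0) (.dia 3 (.var 2)) (.var (a + 3)))
      (.and (.all (.imp (def_num.app₂ (.var 3) (.var 0))
        (.imp (def_rel.app₄ (.var 2) (.var 1) (.var (n + 4)) (.var 0))
          (.eq (.var 0) (.var (b + 4))))))
      (.all (.imp (def_num.app₂ (.var 3) (.var 0)) (.imp (.lt (.var 0) (.var (n + 4)))
        (.all (.imp (def_num.app₂ (.var 4) (.var 0))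
          (.imp (def_rel.app₄ (.var 3) (.var 2) (.var 1) (.var 0))
            (.ex (.and (def_num.app₂ (.var 5) (.var 0))
              (.and (def_rel.app₄ (.var 4) (.var 3) (.dia 3 (.var 2)) (.var 0))
                hP'))))))))))))))
  · rintro D e ⟨w, w', hn, ha, h0, hlast, hstep⟩
    obtain ⟨m, hm, hnum⟩ := hn.exists_eq hα
    obtain rfl := (num_strictMono hα D).injective hm
    have step : ∀ k < e n, ∀ u, Num D (num D u) → Rel w w' (num D k) (num D u) →
        ∃ u', Num D (num D u') ∧ Rel w w' (num D (k + 1)) (num D u') ∧ R e k u u' := by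
      intro k hk u hu hrel
      obtain ⟨u', hu', hrel', hPk⟩ :=
        hstep _ (hnum k hk.le) (num_strictMono hα D hk) _ hu hrel
      obtain ⟨u', rfl, -⟩ := hu'.exists_eq hα
      rw [dia_num] at hrel'
      rw [← comp_cons, ← comp_cons, ← comp_cons] at hPk
      exact ⟨u', hu', hrel', h1 D _ hPk⟩
    -- The coded relation need not be functional; one thread through it is followed, entry by entry.
    have main : ∀ m ≤ e n, ∃ s : ℕ → ℕ, s 0 = e a ∧ (∀ k < m, R e k (s k) (s (k + 1))) ∧
        Num D (num D (s m)) ∧ Rel w w' (num D m) (num D (s m)) := by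
      intro m
      induction m with
      | zero => exact fun _ => ⟨fun _ => e a, rfl, by simp, ha, h0⟩
      | succ m ih =>
        intro hm
        obtain ⟨s, hs0, hs, hsm, hrel⟩ := ih (by omega)
        obtain ⟨u, hu, hrel', hR⟩ := step m (by omega) (s m) hsm hrel
        refine ⟨fun i => if i ≤ m then s i else u, by simpa using hs0, fun k hk => ?_, ?_, ?_⟩
        · rcases Nat.lt_or_ge k m with h | h
          · simpa [h.le, Nat.succ_le_of_lt h] using hs k h
          · obtain rfl : k = m := by omega
            simpa using hR
        · simpa using hu
        · simpa using hrel'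
    obtain ⟨s, hs0, hs, hnum', hrel⟩ := main (e n) le_rfl
    exact ⟨s, hs0, (num_strictMono hα D).injective (hlast _ hnum' hrel), hs⟩
  · rintro e ⟨s, hs0, hsn, hs⟩
    obtain ⟨r₀, hr₀⟩ := exists_bound fun k hk =>
      h2 (WN.cons k (WN.cons (s k) (WN.cons (s (k + 1)) e))) (hs k hk)
    obtain ⟨r₁, hr₁⟩ : ∃ r₁, ∀ k ≤ e n, s k ≤ r₁ :=
      ⟨(Finset.range (e n + 1)).sup s, fun k hk =>
        Finset.le_sup (Finset.mem_range.2 (Nat.lt_succ_of_le hk))⟩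
    -- The base has to contain all arguments and values of the sequence and to be large enough for
    -- each instance of `P`.
    refine ⟨max r₀ (max r₁ (e n)), fun r hr D hD => ?_⟩
    simp only [ge_iff_le, max_le_iff] at hr
    have hle : ∀ k ≤ e n, s k ≤ r := fun k hk => (hr₁ k hk).trans hr.2.1
    obtain ⟨w, w', hw⟩ := hD.2 ((Finset.range (e n + 1)).image fun k => (k, s k)) (by
      intro p hp
      obtain ⟨k, hk, rfl⟩ := Finset.mem_image.1 hp
      have := Finset.mem_range.1 hk
      exact ⟨by dsimp only; omega, hle k (by omega)⟩)
    have hw : ∀ i j, Rel w w' (num D i) (num D j) ↔ i ≤ e n ∧ j = s i := by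
      intro i j
      rw [hw, Finset.mem_image]
      constructor
      · rintro ⟨k, hk, hkij⟩
        simp only [Prod.mk.injEq] at hkij
        have := Finset.mem_range.1 hk
        exact ⟨by omega, by rw [← hkij.1, hkij.2]⟩
      · rintro ⟨hi, rfl⟩
        exact ⟨i, Finset.mem_range.2 (by omega), rfl⟩
    refine ⟨w, w', hD.1 _ hr.2.2, ?_, ?_, ?_, ?_⟩
    · change Num D (num D (e a))
      rw [← hs0]
      exact hD.1 _ (hle 0 (Nat.zero_le _))
    · exact (hw 0 (e a)).2 ⟨Nat.zero_le _, hs0.symm⟩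
    · intro u hu hrel
      obtain ⟨u, rfl, -⟩ := hu.exists_eq hα
      rw [((hw _ _).1 hrel).2, hsn]
    · intro k hk hkn u hu hrel
      obtain ⟨k, rfl, -⟩ := hk.exists_eq hα
      obtain ⟨u, rfl, -⟩ := hu.exists_eq hα
      have hkn := (num_strictMono hα D).lt_iff_lt.1 hkn
      obtain rfl := ((hw _ _).1 hrel).2
      refine ⟨num D (s (k + 1)), hD.1 _ (hle _ hkn), ?_, ?_⟩
      · rw [dia_num]
        exact (hw _ _).2 ⟨hkn, rfl⟩
      · rw [← comp_cons, ← comp_cons, ← comp_cons]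
        exact hr₀ r hr.1 k hkn D hD


/-! ### Recursive functions -/

variable (α) in
/-- The graph of the operation `f` on natural numbers is uniformly definable. -/
def GoodFun (f : (ℕ → ℕ) → ℕ) : Prop := Good α fun e => e 0 = f fun i => e (i + 1)

theorem GoodFun.var (hα : 3 ≤ α) (i : ℕ) : GoodFun α fun e => e i := Good.eq hα 0 (i + 1)

theorem Good.app₂ (hα : 3 ≤ α) {R : ℕ → ℕ → Prop} (h : Good α fun e => R (e 0) (e 1))
    {f g : (ℕ → ℕ) → ℕ} (hf : GoodFun α f) (hg : GoodFun α g) :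
    Good α fun e => R (f e) (g e) := by
  have h1 : Good α fun e => ∃ x, x = f e ∧ ∃ y, y = g e ∧ R x y := by
    refine .ex hα (.and hf (.ex hα (.and ?_ ?_)))
    · exact Good.comp hg fun | 0 => 0 | i + 1 => i + 2
    · exact h.comp fun | 0 => 1 | _ => 0
  exact h1.congr fun e => by simp

theorem GoodFun.app₂ (hα : 3 ≤ α) {F : ℕ → ℕ → ℕ} (h : Good α fun e => e 0 = F (e 1) (e 2))
    {f g : (ℕ → ℕ) → ℕ} (hf : GoodFun α f) (hg : GoodFun α g) :
    GoodFun α fun e => F (f e) (g e) := by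
  have h1 : Good α fun e => ∃ x, x = f (fun i => e (i + 1)) ∧
      ∃ y, y = g (fun i => e (i + 1)) ∧ e 0 = F x y := by
    refine .ex hα (.and ?_ (.ex hα (.and ?_ ?_)))
    · exact Good.comp hf fun | 0 => 0 | i + 1 => i + 2
    · exact Good.comp hg fun | 0 => 0 | i + 1 => i + 3
    · exact h.comp fun | 0 => 2 | 1 => 1 | _ => 0
  exact h1.congr fun e => by simp

/-- Addition iterates the successor, as multiplication below iterates addition. -/
theorem good_add (hα : 3 ≤ α) : Good α fun e => e 0 = e 1 + e 2 := by
  refine (Good.iter hα (R := fun _ _ u v => v = u + 1) (Good.eq_succ hα 2 1) 1 0 2).congr ?_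
  intro e
  constructor
  · rintro ⟨s, h0, hn, hs⟩
    have : ∀ k ≤ e 2, s k = e 1 + k := by
      intro k
      induction k with
      | zero => intro _; simpa using h0
      | succ k ih => intro hk; rw [hs k (by omega), ih (by omega)]; omega
    rw [← hn, this _ le_rfl]
  · intro h
    exact ⟨fun k => e 1 + k, by simp, h.symm, fun k _ => (Nat.add_assoc _ _ _).symm⟩

theorem GoodFun.add (hα : 3 ≤ α) {f g : (ℕ → ℕ) → ℕ} (hf : GoodFun α f) (hg : GoodFun α g) :
    GoodFun α fun e => f e + g e := .app₂ hα (good_add hα) hf hg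

theorem Good.eq_fun (hα : 3 ≤ α) {f g : (ℕ → ℕ) → ℕ} (hf : GoodFun α f) (hg : GoodFun α g) :
    Good α fun e => f e = g e := .app₂ hα (Good.eq hα 0 1) hf hg

theorem good_mul (hα : 3 ≤ α) : Good α fun e => e 0 = e 1 * e 2 := by
  have h : Good α fun e => ∃ z, z = 0 ∧ ∃ s : ℕ → ℕ, s 0 = z ∧ s (e 2) = e 0 ∧
      ∀ k < e 2, s (k + 1) = s k + e 1 := by
    -- `Good.iter` starts from the value of a variable, so the initial value `0` is introduced by a
    -- quantifier.
    refine .ex hα (.and (Good.eq_zero hα 0) ?_)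
    exact Good.iter hα (R := fun e _ u v => v = u + e 2)
      ((good_add hα).comp fun | 0 => 2 | 1 => 1 | _ => 5) 0 1 3
  refine h.congr fun e => ?_
  constructor
  · rintro ⟨z, rfl, s, h0, hn, hs⟩
    have : ∀ k ≤ e 2, s k = e 1 * k := by
      intro k
      induction k with
      | zero => intro _; simpa using h0
      | succ k ih => intro hk; rw [hs k (by omega), ih (by omega)]; ring
    rw [← hn, this _ le_rfl]
  · intro h
    exact ⟨0, rfl, fun k => e 1 * k, by simp, h.symm, fun k _ => by ring⟩

theorem GoodFun.mul (hα : 3 ≤ α) {f g : (ℕ → ℕ) → ℕ} (hf : GoodFun α f) (hg : GoodFun α g) :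
    GoodFun α fun e => f e * g e := .app₂ hα (good_mul hα) hf hg

theorem good_pair (hα : 3 ≤ α) : Good α fun e => e 0 = Nat.pair (e 1) (e 2) := by
  have v := GoodFun.var hα
  have h : Good α fun e => (e 1 < e 2 ∧ e 0 = e 2 * e 2 + e 1) ∨
      ((e 2 < e 1 ∨ e 2 = e 1) ∧ e 0 = e 1 * e 1 + e 1 + e 2) :=
    .or (.and (Good.lt hα 1 2) (.eq_fun hα (v 0) (.add hα (.mul hα (v 2) (v 2)) (v 1))))
      (.and (.or (Good.lt hα 2 1) (Good.eq hα 2 1))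
        (.eq_fun hα (v 0) (.add hα (.add hα (.mul hα (v 1) (v 1)) (v 1)) (v 2))))
  refine h.congr fun e => ?_
  rw [Nat.pair, ← le_iff_lt_or_eq]
  split_ifs with h1
  · have := not_le.2 h1
    tauto
  · have := not_lt.1 h1
    tauto

theorem GoodFun.pair (hα : 3 ≤ α) {f g : (ℕ → ℕ) → ℕ} (hf : GoodFun α f) (hg : GoodFun α g) :
    GoodFun α fun e => Nat.pair (f e) (g e) := .app₂ hα (good_pair hα) hf hg

open Nat.Partrec (Code)

/-- Brings primitive recursion with partial values into the form of a finite computation sequence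
handled by `Good.iter`. -/
theorem mem_rec_iff {g : Part ℕ} {h : ℕ → ℕ → Part ℕ} {n b : ℕ} :
    (b ∈ (Nat.rec g (fun y IH => IH.bind fun i => h y i) n : Part ℕ)) ↔
      ∃ s : ℕ → ℕ, s 0 ∈ g ∧ s n = b ∧ ∀ k < n, s (k + 1) ∈ h k (s k) := by
  induction n generalizing b with
  | zero =>
    constructor
    · intro hb
      exact ⟨fun _ => b, hb, rfl, by simp⟩
    · rintro ⟨s, h0, rfl, -⟩
      exact h0
  | succ n ih =>
    simp only [Part.mem_bind_iff, ih]
    constructor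
    · rintro ⟨_, ⟨s, h0, rfl, hs⟩, hb⟩
      refine ⟨fun k => if k ≤ n then s k else b, by simpa using h0, by simp, fun k hk => ?_⟩
      rcases Nat.lt_or_ge k n with hkn | hkn
      · simpa [hkn.le, Nat.succ_le_of_lt hkn] using hs k hkn
      · obtain rfl : k = n := by omega
        simpa using hb
    · rintro ⟨s, h0, rfl, hs⟩
      exact ⟨s n, ⟨s, h0, rfl, fun k hk => hs k (by omega)⟩, hs n (by omega)⟩

/-- The graphs of all partial recursive functions are uniformly definable. -/
theorem good_eval (hα : 3 ≤ α) (c : Code) : Good α fun e => e 0 ∈ c.eval (e 1) := by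
  have v := GoodFun.var hα
  induction c with
  | zero => exact (Good.eq_zero hα 0).congr fun e => by simp [Code.eval, pure, PFun.pure]
  | succ => exact (Good.eq_succ hα 0 1).congr fun e => by simp [Code.eval]
  | left =>
    have h : Good α fun e => ∃ y, e 1 = Nat.pair (e 0) y :=
      .ex hα (.eq_fun hα (v 2) (.pair hα (v 1) (v 0)))
    refine h.congr fun e => ?_
    simp only [Code.eval, PFun.coe_val, Part.mem_some_iff]
    constructor
    · rintro ⟨y, h⟩
      simp [h]
    · intro h
      exact ⟨(e 1).unpair.2, by rw [h, Nat.pair_unpair]⟩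
  | right =>
    have h : Good α fun e => ∃ y, e 1 = Nat.pair y (e 0) :=
      .ex hα (.eq_fun hα (v 2) (.pair hα (v 0) (v 1)))
    refine h.congr fun e => ?_
    simp only [Code.eval, PFun.coe_val, Part.mem_some_iff]
    constructor
    · rintro ⟨y, h⟩
      simp [h]
    · intro h
      exact ⟨(e 1).unpair.1, by rw [h, Nat.pair_unpair]⟩
  | pair cf cg hf hg =>
    have h : Good α fun e => ∃ x, x ∈ cf.eval (e 1) ∧ ∃ y, y ∈ cg.eval (e 1) ∧
        e 0 = Nat.pair x y :=
      -- Only the images of the indices `0` and `1` matter: under one or two quantifiers the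
      -- argument `e 1` moves to index `2` or `3`.
      .ex hα (.and (hf.comp fun i => 2 * i) (.ex hα (.and (hg.comp fun i => 3 * i)
        (.eq_fun hα (v 2) (.pair hα (v 1) (v 0))))))
    refine h.congr fun e => ?_
    simp [Code.eval, Seq.seq, eq_comm]
  | comp cf cg hf hg =>
    have h : Good α fun e => ∃ x, x ∈ cg.eval (e 1) ∧ e 0 ∈ cf.eval x :=
      .ex hα (.and (hg.comp fun i => 2 * i) (hf.comp fun i => 1 - i))
    refine h.congr fun e => ?_
    exact Part.mem_bind_iff.symm
  | prec cf cg hf hg =>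
    have hstep : Good α fun e => e 2 ∈ cg.eval (Nat.pair (e 4) (Nat.pair (e 0) (e 1))) :=
      .app₂ hα (R := fun x y => x ∈ cg.eval y) hg (v 2) (.pair hα (v 4) (.pair hα (v 0) (v 1)))
    have h : Good α fun e => ∃ n a, e 1 = Nat.pair a n ∧ ∃ x, x ∈ cf.eval a ∧
        ∃ s : ℕ → ℕ, s 0 = x ∧ s n = e 0 ∧
          ∀ k < n, s (k + 1) ∈ cg.eval (Nat.pair a (Nat.pair k (s k))) := by
      refine .ex hα (.ex hα (.and (.eq_fun hα (v 3) (.pair hα (v 0) (v 1)))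
        (.ex hα (.and (hf.comp fun i => i) ?_))))
      exact Good.iter hα (R := fun e k u u' => u' ∈ cg.eval (Nat.pair (e 1) (Nat.pair k u)))
        hstep 0 3 2
    refine h.congr fun e => ?_
    simp only [Code.eval, Nat.unpaired]
    refine Iff.trans ?_ mem_rec_iff.symm
    constructor
    · rintro ⟨n, a, h1, x, hx, s, rfl, hn, hs⟩
      simp only [h1, Nat.unpair_pair]
      exact ⟨s, hx, hn, hs⟩
    · rintro ⟨s, h0, hn, hs⟩
      exact ⟨_, _, (Nat.pair_unpair (e 1)).symm, s 0, h0, s, rfl, hn, hs⟩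
  | rfind' cf hf =>
    -- Minimality is expressed positively, by a nonzero value at each smaller argument, so no
    -- negation is needed.
    have h : Good α fun e => ∃ m a, e 1 = Nat.pair a m ∧ ∃ n, e 0 = n + m ∧
        (∃ z, z = 0 ∧ z ∈ cf.eval (Nat.pair a (n + m))) ∧
        ∀ k < n, ∃ z, (∃ w, w = 0 ∧ w < z) ∧ z ∈ cf.eval (Nat.pair a (k + m)) := by
      refine .ex hα (.ex hα (.and (.eq_fun hα (v 3) (.pair hα (v 0) (v 1))) (.ex hα
        (.and (.eq_fun hα (v 3) (.add hα (v 0) (v 2))) (.and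
          (.ex hα (.and (Good.eq_zero hα 0)
            (.app₂ hα (R := fun x y => x ∈ cf.eval y) hf (v 0)
              (.pair hα (v 2) (.add hα (v 1) (v 3))))))
          (.ball hα (.ex hα (.and (.ex hα (.and (Good.eq_zero hα 0) (Good.lt hα 0 1))) ?_)) 0))))))
      exact .app₂ hα (R := fun x y => x ∈ cf.eval y) hf (v 0) (.pair hα (v 3) (.add hα (v 1) (v 4)))
    refine h.congr fun e => ?_
    simp only [Code.eval, Nat.unpaired]
    refine Iff.trans ?_ (Part.mem_map_iff _).symm
    constructor
    · rintro ⟨m, a, h1, n, hn, ⟨z, rfl, h0⟩, hlt⟩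
      simp only [h1, Nat.unpair_pair]
      refine ⟨n, Nat.mem_rfind.2 ⟨(Part.mem_map_iff _).2 ⟨0, h0, by simp⟩, fun {k} hk => ?_⟩,
        hn.symm⟩
      obtain ⟨z, ⟨w, rfl, hz⟩, hz'⟩ := hlt k hk
      exact (Part.mem_map_iff _).2 ⟨z, hz', by simpa using hz.ne'⟩
    · rintro ⟨n, hrf, hn⟩
      obtain ⟨h0, hlt⟩ := Nat.mem_rfind.1 hrf
      obtain ⟨z, hz, hz0⟩ := (Part.mem_map_iff _).1 h0
      refine ⟨_, _, (Nat.pair_unpair (e 1)).symm, n, hn.symm, ⟨z, by simpa using hz0, hz⟩,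
        fun k hk => ?_⟩
      obtain ⟨z, hz, hz0⟩ := (Part.mem_map_iff _).1 (hlt hk)
      exact ⟨z, ⟨0, rfl, Nat.pos_of_ne_zero (by simpa using hz0)⟩, hz⟩


/-! ### Undecidability -/

/-- With one universal function the halting problem becomes a single domain, so one formula with a
varying numeral suffices. -/
theorem exists_universal_code : ∃ u : Code, ∀ c : Code, u.eval (Encodable.encode c) = c.eval 0 := by
  have h : Partrec fun n : ℕ => (Denumerable.ofNat Code n).eval 0 :=
    Code.eval_part.comp (Computable.ofNat Code) (Computable.const 0)
  obtain ⟨u, hu⟩ := Code.exists_code.1 (Partrec.nat_iff.1 h)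
  exact ⟨u, fun c => (congrFun hu _).trans (by rw [Denumerable.ofNat_encode])⟩

/-- The domain of a partial recursive function is uniformly definable over all bases. -/
theorem exists_def_dom (hα : 3 ≤ α) (u : Code) : ∃ P : WN α → WN α → Prop,
    (Def fun v => P (v 0) (v 1)) ∧ ∀ n, (u.eval n).Dom ↔ ∃ D, P D (num D n) := by
  have h : Good α fun e => ∃ y, y ∈ u.eval (e 0) := .ex hα (good_eval hα u)
  obtain ⟨P, hP, h1, h2⟩ := h
  refine ⟨fun D a => P D fun _ => a, hP.comp fun | 0 => 0 | _ => 1, fun n => ?_⟩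
  rw [Part.dom_iff_mem]
  constructor
  · intro hn
    obtain ⟨r, hr⟩ := h2 (fun _ => n) hn
    obtain ⟨D, hD⟩ := exists_base hα r
    exact ⟨D, hr r le_rfl D hD⟩
  · rintro ⟨D, hD⟩
    exact h1 D (fun _ => n) hD

/-- The term `◇₃ t`. -/
def diaTerm (h : ((3 : ℕ) : ℕ∞) ≤ α) (t : (notationLanguage α).Term (Empty ⊕ Fin 2)) :
    (notationLanguage α).Term (Empty ⊕ Fin 2) :=
  .func (NotationFunc.diamond 3 h : (notationLanguage α).Functions 1) fun _ => t

theorem realize_diaTerm_iterate (h : ((3 : ℕ) : ℕ∞) ≤ α) (n : ℕ)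
    (t : (notationLanguage α).Term (Empty ⊕ Fin 2)) (v : Empty ⊕ Fin 2 → WN α) :
    ((diaTerm h)^[n] t).realize v = (dia 3)^[n] (t.realize v) := by
  have : Function.Semiconj (fun t : (notationLanguage α).Term (Empty ⊕ Fin 2) => t.realize v)
      (diaTerm h) (dia 3) := fun t => by
    rw [WN.dia, dif_pos h]
    rfl
  exact (this.iterate_right n).eq t

theorem termCode_diaTerm_iterate (h : ((3 : ℕ) : ℕ∞) ≤ α) (n : ℕ)
    (t : (notationLanguage α).Term (Empty ⊕ Fin 2)) :
    termCode ((diaTerm h)^[n] t) = (fun k => Nat.pair 2 (Nat.pair 3 k))^[n] (termCode t) :=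
  Function.Semiconj.iterate_right (f := termCode (α := α) (n := 2)) (fun _ => rfl) n t

/-- The sentence `∀ x y, y = ◇₃ ⋯ ◇₃ x → ψ x y` with `n` operators `◇₃`. -/
def iterateSentence (h : ((3 : ℕ) : ℕ∞) ≤ α) (ψ : (notationLanguage α).BoundedFormula Empty 2)
    (n : ℕ) : (notationLanguage α).Sentence :=
  .all (.all (.imp (.equal (.var (Sum.inr 1)) ((diaTerm h)^[n] (.var (Sum.inr 0)))) ψ))

/-- Only the iterated term depends on `n`; its Gödel number is a primitive recursive iterate, and
that of `ψ` is a constant. -/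
theorem computable_formulaCode_iterateSentence (h : ((3 : ℕ) : ℕ∞) ≤ α)
    (ψ : (notationLanguage α).BoundedFormula Empty 2) :
    Computable fun n => formulaCode (iterateSentence h ψ n) := by
  have e : (fun n => formulaCode (iterateSentence h ψ n)) = fun n => Nat.pair 4 (Nat.pair 4
      (Nat.pair 3 (Nat.pair (Nat.pair 1 (Nat.pair (Nat.pair 0 1)
        ((fun k => Nat.pair 2 (Nat.pair 3 k))^[n] (Nat.pair 0 0)))) (formulaCode ψ)))) :=
    funext fun n => by
      rw [iterateSentence, formulaCode, formulaCode, formulaCode, formulaCode,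
        termCode_diaTerm_iterate]
      rfl
  rw [e]
  have p : ∀ {f g : ℕ → ℕ}, Primrec f → Primrec g → Primrec fun n => Nat.pair (f n) (g n) :=
    fun hf hg => Primrec₂.natPair.comp hf hg
  have c : ∀ k : ℕ, Primrec fun _ : ℕ => k := Primrec.const
  have hit : Primrec fun n : ℕ => (fun k => Nat.pair 2 (Nat.pair 3 k))^[n] (Nat.pair 0 0) :=
    Primrec.nat_iterate Primrec.id (c _)
      (Primrec₂.natPair.comp (Primrec.const 2)
        (Primrec₂.natPair.comp (Primrec.const 3) Primrec.snd)).to₂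
  exact (p (c 4) (p (c 4) (p (c 3) (p (p (c 1) (p (c _) hit)) (c _))))).to_comp

theorem realize_iterateSentence (h : ((3 : ℕ) : ℕ∞) ≤ α) {P : WN α → WN α → Prop}
    (hP : Def fun v => P (v 0) (v 1)) : ∃ ψ : (notationLanguage α).BoundedFormula Empty 2,
      ∀ n, (WN α) ⊨ iterateSentence h ψ n ↔ ∀ D, P D ((dia 3)^[n] D) := by
  obtain ⟨φ, hφ⟩ := hP
  -- Sending all indices from `1` on to the second variable is harmless, since the truth of `φ`
  -- depends only on the values at `0` and `1`.
  let g : ℕ → Empty ⊕ Fin 2 := fun n => Nat.casesOn n (Sum.inr 0) fun _ => Sum.inr 1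
  let ψ : (notationLanguage α).BoundedFormula Empty 2 :=
    FirstOrder.Language.BoundedFormula.relabel (k := 0) g φ
  have hψ : ∀ (v : Empty → WN α) (xs : Fin 2 → WN α), ψ.Realize v xs ↔ P (xs 0) (xs 1) := by
    intro v xs
    refine (FirstOrder.Language.BoundedFormula.realize_relabel (n := 0)).trans ?_
    have key : ∀ (w : ℕ → WN α) (ys : Fin 0 → WN α),
        FirstOrder.Language.BoundedFormula.Realize φ w ys ↔ P (w 0) (w 1) := fun w ys => by
      rw [Subsingleton.elim ys default]
      exact hφ w
    exact key _ _
  refine ⟨ψ, fun n => ?_⟩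
  have h1 : (WN α) ⊨ iterateSentence h ψ n ↔ ∀ D x : WN α,
      x = ((diaTerm h)^[n] (.var (Sum.inr 0))).realize
        (Sum.elim (default : Empty → WN α) ![D, x]) → ψ.Realize default ![D, x] := by
    refine forall_congr' fun D => forall_congr' fun x => ?_
    have e : (Fin.snoc (Fin.snoc default D : Fin 1 → WN α) x : Fin 2 → WN α) = ![D, x] := by
      funext i
      fin_cases i <;> rfl
    change (_ = _ → FirstOrder.Language.BoundedFormula.Realize ψ default _) ↔ _
    rw [e]
    rfl
  rw [h1]
  simp only [realize_diaTerm_iterate, hψ]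
  exact ⟨fun H D => H D _ rfl, fun H D x hx => hx ▸ H D⟩

end WN

end WordNotation

theorem mainTheorem2 (α : ℕ∞) (hα : 3 ≤ α) :
    ¬ WordNotation.IsDecidableTheory
      ((WordNotation.notationLanguage α).completeTheory (WordNotation.WN α)) := by
  intro hdec
  obtain ⟨u, hu⟩ := WordNotation.WN.exists_universal_code
  obtain ⟨P, hP, hdom⟩ := WordNotation.WN.exists_def_dom hα u
  have h3 := WordNotation.WN.natCast_le hα (le_refl 3)
  obtain ⟨ψ, hψ⟩ := WordNotation.WN.realize_iterateSentence h3 (P := fun D x => ¬ P D x) hP.not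
  have hcode := WordNotation.WN.computable_formulaCode_iterateSentence h3 ψ
  -- The `+ 1` occurs because the number `n` over `D` is the `(n + 1)`-st iterate of `◇₃` at `D`.
  have hiff : ∀ c : Nat.Partrec.Code, (∃ φ ∈ (WordNotation.notationLanguage α).completeTheory
      (WordNotation.WN α),
      WordNotation.formulaCode φ = WordNotation.formulaCode
        (WordNotation.WN.iterateSentence h3 ψ (Encodable.encode c + 1))) ↔
      ¬ (c.eval 0).Dom := by
    intro c
    rw [← hu, hdom, not_exists]
    refine Iff.trans ?_ (hψ _)
    constructor
    · rintro ⟨φ, hφ, h⟩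
      rwa [← WordNotation.formulaCode_injective h]
    · exact fun h => ⟨_, h, rfl⟩
  have hred : ComputablePred fun c : Nat.Partrec.Code => ¬ (c.eval 0).Dom := by
    obtain ⟨hd, hc⟩ := hdec
    refine ComputablePred.of_eq (p := fun c : Nat.Partrec.Code =>
      ∃ φ ∈ (WordNotation.notationLanguage α).completeTheory
      (WordNotation.WN α),
        WordNotation.formulaCode φ = WordNotation.formulaCode
        (WordNotation.WN.iterateSentence h3 ψ (Encodable.encode c + 1)))
      ⟨fun c => hd _, hc.comp (hcode.comp (Computable.succ.comp Computable.encode))⟩ hiff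
  exact ComputablePred.halting_problem 0 (hred.not.of_eq fun c => not_not)
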